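/- Let $\Bbbk$ be a commutative unital ring. **Walled categories.** Put $\mathbf 1=\{1\}$ and $\mathbf 2=\{1,2\}$. The category $\mathfrak C$ (respectively $\mathfrak D$) has as objects the pairs $(X,Y)$ of finite sets; a morphism $(X,Y)\to(U,V)$ is a triple $(i,j,\zeta)$ of injections $i:X\hookrightarrow U$, $j:Y\hookrightarrow V$ and $\zeta:V\setminus j(Y)\hookrightarrow U\setminus i(X)$ (respectively $\zeta:\mathbf 2\times (V\setminus j(Y))\hookrightarrow U\setminus i(X)$). The composite of $(i,j,\zeta):(X,Y)\to(U,V)$ with $(i',j',\zeta'):(U,V)\to(W,Z)$ is $(i'i,\,j'j,\,\zeta'')$, where $\zeta''$ is $\zeta'$ on the part indexed by $Z\setminus j'(V)$ and is $i'\zeta$ on the part indexed by $j'(V\setminus j(Y))\cong V\setminus j(Y)$. Let $\mathfrak C_0\subset\mathfrak C$ and $\mathfrak D_0\subset\mathfrak D$ be the wide subcategories of the morphisms with $\zeta$ bijective. For a category $\mathcal A$, $\mathcal F(\mathcal A)$ is the category of functors from $\mathcal A$ to $\Bbbk$-modules. Extension by zero $\mathcal F(\mathfrak C_0)\to\mathcal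 F(\mathfrak C)$, in which the morphisms outside $\mathfrak C_0$ act by $0$, has a left adjoint $H^{\mathfrak C}_{\mathfrak C_0}:\mathcal F(\mathfrak C)\to\mathcal F(\mathfrak C_0)$. **Antisymmetrization.** For each $(X,Y)$ let $\iota_{(X,Y)}:(X,Y)\to(X\amalg\mathbf 2,Y\amalg\mathbf 1)$ be the morphism of $\mathfrak D_0$ given by the canonical inclusions and the canonical bijection $\mathbf 2\times\mathbf 1\cong\mathbf 2$, and let $\tau_{(X,Y)}$ be obtained from it by exchanging the two elements of $\mathbf 2$. Let $\mathfrak E$ be the quotient of the $\Bbbk$-linearization $\Bbbk\mathfrak D$ by the two-sided ideal generated by all the $\iota_{(X,Y)}+\tau_{(X,Y)}$, and let $\mathfrak E_0\subset\mathfrak E$ be the wide subcategory given by the image of $\Bbbk\mathfrak D_0$. Write $\mathfrak E\text{-mod}$, $\mathfrak E_0\text{-mod}$ for the categories of $\Bbbk$-linear functors from $\mathfrak E$, $\mathfrak E_0$ to $\Bbbk$-modules. Extension by zero $\mathfrak E_0\text{-mod}\to\mathfrak E\text{-mod}$ (the class of a morphism of $\mathfrak D$ acts through $\mathfrak E_0$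 if it lies in $\mathfrak D_0$, and by $0$ otherwise) has a left adjoint $H^{\mathfrak E}_{\mathfrak E_0}$. The restriction functor $\mathfrak E_0\text{-mod}\hookrightarrow\mathcal F(\mathfrak D_0)$ has a left adjoint $\mathsf q^{\pm}:\mathcal F(\mathfrak D_0)\to\mathfrak E_0\text{-mod}$. **Induction.** The functor $\mathrm{Ind}:\mathcal F(\mathfrak C)\to\mathcal F(\mathfrak D)$ is given by $$\mathrm{Ind}\,F(U,V)=\bigoplus_{\kappa:V\hookrightarrow U}F\bigl(U\setminus\kappa(V),V\bigr);$$ a morphism $(i,j,\zeta):(X,Y)\to(U,V)$ of $\mathfrak D$ maps the summand of $\kappa:Y\hookrightarrow X$ to that of $\kappa':V\hookrightarrow U$, where $\kappa'j=i\kappa$ and $\kappa'=\zeta(1,-)$ on $V\setminus j(Y)$, by $F(i|,j,\zeta(2,-))$. It restricts, along extension by zero, to $\mathrm{Ind}_0:\mathcal F(\mathfrak C_0)\to\mathcal F(\mathfrak D_0)$. **The two modules.** The functor $\Bbbk\hom_{\mathbf{FI}}(-,-)^{\mathrm{tr}}\in\mathcal F(\mathfrak C)$ takes $(X,Y)$ to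 the free $\Bbbk$-module on the set of injections $X\hookrightarrow Y$; a morphism $(i,j,\alpha):(X,Y)\to(U,V)$ sends $[a]$ to the sum of the $[b]$ over all the injections $b:U\hookrightarrow V$ such that $b\,i=j\,a$ and $b(\alpha(v))=v$ for all $v\in V\setminus j(Y)$. Let $\mathsf{Beads}^{[1,2]}(X,Y)$ be the set of arrangements of beads labelled bijectively by $X$ into columns indexed by $Y$, each column containing one bead or an ordered pair of beads (bottom, top). The free modules $\Bbbk\mathsf{Beads}^{[1,2]}(X,Y)$ form an object of $\mathcal F(\mathfrak D)$: a morphism $(i,j,\zeta):(X,Y)\to(U,V)$ sends $[\varphi]$ to the sum of the $[\psi]$ over all the $\psi\in\mathsf{Beads}^{[1,2]}(U,V)$ in which, for every $x\in X$ that $\varphi$ puts in the column $y$, the bead $i(x)$ lies in the column $j(y)$, in the same row, and in which the column of each $v\in V\setminus j(Y)$ has bottom bead $\zeta(1,v)$ and top bead $\zeta(2,v)$. Let $\mathsf{Beads}^{[1,2],\pm}_{\Bbbk}(X,Y)$ be the quotient of $\Bbbk\mathsf{Beads}^{[1,2]}(X,Y)$ by the relations $[\varphi]+[\tau\varphi]=0$,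 where $\varphi$ is a bead arrangement and $\tau$ is the transposition exchanging the two labels of a column of $\varphi$ of cardinal two. These quotients form a quotient object in $\mathcal F(\mathfrak D)$, on which $\iota_{(X,Y)}+\tau_{(X,Y)}$ acts by $0$, hence an $\mathfrak E$-module $\mathsf{Beads}^{[1,2],\pm}_{\Bbbk}(-,-)$. **Corollary.** There is an isomorphism in $\mathfrak E_0\text{-mod}$: $$H^{\mathfrak E}_{\mathfrak E_0}\,\mathsf{Beads}^{[1,2],\pm}_{\Bbbk}(-,-)\;\cong\;\mathsf q^{\pm}\,\mathrm{Ind}_0\bigl(H^{\mathfrak C}_{\mathfrak C_0}\,\Bbbk\hom_{\mathbf{FI}}(-,-)^{\mathrm{tr}}\bigr).$$ -/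

import Mathlib

open CategoryTheory

universe u

/-- A pair `(X, Y)` of finite sets, regarded as an object of the walled category of type `T`. -/
structure Walled (T : Type) : Type (u + 1) where
  X : Type u
  Y : Type u
  [finX : Finite X]
  [finY : Finite Y]

namespace Walled

attribute [instance] Walled.finX Walled.finY

variable {T : Type}

/-- A morphism `(X, Y) ⟶ (U, V)`: injections `i : X ↪ U`, `j : Y ↪ V` together with an injection
`ζ : T × (V ∖ j(Y)) ↪ U ∖ i(X)`. -/
structure Hom (P Q : Walled.{u} T) : Type u where
  i : P.X ↪ Q.X
  j : P.Y ↪ Q.Y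
  ζ : T × ↥(Set.range j)ᶜ ↪ ↥(Set.range i)ᶜ

theorem Hom.ext_apply {P Q : Walled.{u} T} {f g : Hom P Q} (hi : ∀ x, f.i x = g.i x)
    (hj : ∀ y, f.j y = g.j y)
    (hζ : ∀ t v hv hv', (f.ζ (t, ⟨v, hv⟩)).1 = (g.ζ (t, ⟨v, hv'⟩)).1) : f = g := by
  obtain ⟨i, j, ζ⟩ := f
  obtain ⟨i', j', ζ'⟩ := g
  obtain rfl : i = i' := DFunLike.ext _ _ hi
  obtain rfl : j = j' := DFunLike.ext _ _ hj
  congr 1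
  ext ⟨t, v, hv⟩
  exact hζ t v hv hv

/-- The identity morphism; the complements are empty. -/
def Hom.id (P : Walled.{u} T) : Hom P P where
  i := .refl _
  j := .refl _
  ζ := ⟨fun p => (p.2.2 ⟨p.2.1, rfl⟩).elim, fun p => (p.2.2 ⟨p.2.1, rfl⟩).elim⟩

theorem Hom.ζ_ne {P Q : Walled.{u} T} (f : Hom P Q) (p) (x : P.X) : f.i x ≠ (f.ζ p).1 :=
  fun h => (f.ζ p).2 ⟨x, h⟩

open Classical in
/-- For composable morphisms `f` and `g`, the third component of `f ≫ g`: on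
`T × (Z ∖ g(V))` it is given by `g`, on `T × g(V ∖ f(Y))` by `f`, transported along `g`. -/
noncomputable def Hom.compFun {P Q R : Walled.{u} T} (f : Hom P Q) (g : Hom Q R)
    (p : T × ↥(Set.range (f.j.trans g.j))ᶜ) : R.X :=
  if h : p.2.1 ∈ Set.range g.j then
    g.i (f.ζ (p.1, ⟨h.choose, fun ⟨y, hy⟩ => p.2.2 ⟨y, by
      simp only [Function.Embedding.trans_apply, hy]; exact h.choose_spec⟩⟩)).1
  else (g.ζ (p.1, ⟨p.2.1, h⟩)).1

theorem Hom.compFun_of_mem {P Q R : Walled.{u} T} (f : Hom P Q) (g : Hom Q R) (t : T) (v : Q.Y)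
    (hv : v ∈ (Set.range f.j)ᶜ) (h : g.j v ∈ (Set.range (f.j.trans g.j))ᶜ) :
    f.compFun g (t, ⟨g.j v, h⟩) = g.i (f.ζ (t, ⟨v, hv⟩)).1 := by
  have hm : g.j v ∈ Set.range g.j := ⟨v, rfl⟩
  have : hm.choose = v := g.j.injective hm.choose_spec
  simp only [compFun, hm, dif_pos, this]

theorem Hom.compFun_of_notMem {P Q R : Walled.{u} T} (f : Hom P Q) (g : Hom Q R) (t : T) (z : R.Y)
    (hz : z ∈ (Set.range g.j)ᶜ) (h : z ∈ (Set.range (f.j.trans g.j))ᶜ) :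
    f.compFun g (t, ⟨z, h⟩) = (g.ζ (t, ⟨z, hz⟩)).1 := by
  have hz' : z ∉ Set.range g.j := hz
  simp only [compFun, hz', dif_neg, not_false_eq_true]

/-- An element of the complement of the image of `f ≫ g` on second sets either comes from the
complement of the image of `f` or lies in the complement of the image of `g`. -/
theorem Hom.compl_cases {P Q R : Walled.{u} T} (f : Hom P Q) (g : Hom Q R) {z : R.Y}
    (h : z ∈ (Set.range (f.j.trans g.j))ᶜ) :
    (∃ v, v ∈ (Set.range f.j)ᶜ ∧ g.j v = z) ∨ z ∈ (Set.range g.j)ᶜ := by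
  by_cases hz : z ∈ Set.range g.j
  · obtain ⟨v, rfl⟩ := hz
    exact Or.inl ⟨v, fun ⟨y, hy⟩ => h ⟨y, by simp [hy]⟩, rfl⟩
  · exact Or.inr hz

/-- Composition of morphisms. -/
noncomputable def Hom.comp {P Q R : Walled.{u} T} (f : Hom P Q) (g : Hom Q R) : Hom P R where
  i := f.i.trans g.i
  j := f.j.trans g.j
  ζ := ⟨fun p => ⟨f.compFun g p, by
      obtain ⟨t, z, hz⟩ := p
      rintro ⟨x, hx⟩
      rcases f.compl_cases g hz with ⟨v, hv, rfl⟩ | hz'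
      · rw [compFun_of_mem f g t v hv hz] at hx
        exact f.ζ_ne _ _ (g.i.injective hx)
      · rw [compFun_of_notMem f g t z hz' hz] at hx
        exact g.ζ_ne _ _ hx⟩, by
      rintro ⟨t, z, hz⟩ ⟨t', z', hz'⟩ h
      have h := congrArg Subtype.val h
      dsimp only at h
      rcases f.compl_cases g hz with ⟨v, hv, rfl⟩ | hw <;>
        rcases f.compl_cases g hz' with ⟨v', hv', rfl⟩ | hw'
      · rw [compFun_of_mem f g t v hv hz, compFun_of_mem f g t' v' hv' hz'] at h
        have := f.ζ.injective (Subtype.ext (g.i.injective h))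
        simp only [Prod.mk.injEq, Subtype.mk.injEq] at this
        obtain ⟨rfl, rfl⟩ := this
        rfl
      · rw [compFun_of_mem f g t v hv hz, compFun_of_notMem f g t' z' hw' hz'] at h
        exact (g.ζ_ne _ _ h).elim
      · rw [compFun_of_notMem f g t z hw hz, compFun_of_mem f g t' v' hv' hz'] at h
        exact (g.ζ_ne _ _ h.symm).elim
      · rw [compFun_of_notMem f g t z hw hz, compFun_of_notMem f g t' z' hw' hz'] at h
        have := g.ζ.injective (Subtype.ext h)
        simp only [Prod.mk.injEq, Subtype.mk.injEq] at this
        obtain ⟨rfl, rfl⟩ := this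
        rfl⟩

theorem Hom.comp_ζ_of_mem {P Q R : Walled.{u} T} (f : Hom P Q) (g : Hom Q R) (t : T) (v : Q.Y)
    (hv : v ∈ (Set.range f.j)ᶜ) (h : g.j v ∈ (Set.range (f.comp g).j)ᶜ) :
    ((f.comp g).ζ (t, ⟨g.j v, h⟩)).1 = g.i (f.ζ (t, ⟨v, hv⟩)).1 :=
  f.compFun_of_mem g t v hv h

theorem Hom.comp_ζ_of_notMem {P Q R : Walled.{u} T} (f : Hom P Q) (g : Hom Q R) (t : T) (z : R.Y)
    (hz : z ∈ (Set.range g.j)ᶜ) (h : z ∈ (Set.range (f.comp g).j)ᶜ) :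
    ((f.comp g).ζ (t, ⟨z, h⟩)).1 = (g.ζ (t, ⟨z, hz⟩)).1 :=
  f.compFun_of_notMem g t z hz h

/-- The category of pairs of finite sets with the morphisms above. -/
noncomputable instance : Category (Walled.{u} T) where
  Hom P Q := Hom P Q
  id P := Hom.id P
  comp f g := Hom.comp f g
  id_comp {P Q} f := Hom.ext_apply (fun _ => rfl) (fun _ => rfl) fun t v hv hv' =>
    Hom.comp_ζ_of_notMem _ f t v hv' hv
  comp_id {P Q} f := Hom.ext_apply (fun _ => rfl) (fun _ => rfl) fun t v hv hv' =>
    Hom.comp_ζ_of_mem f (Hom.id Q) t v hv' hv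
  assoc {P Q R S} f g h := Hom.ext_apply (fun _ => rfl) (fun _ => rfl) fun t v hv hv' => by
    rcases Hom.compl_cases (f.comp g) h hv with ⟨w, hw, rfl⟩ | hz
    · rw [Hom.comp_ζ_of_mem _ h t w hw hv]
      rcases Hom.compl_cases f g hw with ⟨y, hy, rfl⟩ | hz
      · rw [Hom.comp_ζ_of_mem f g t y hy hw]
        exact (Hom.comp_ζ_of_mem f (g.comp h) t y hy hv').symm
      · rw [Hom.comp_ζ_of_notMem f g t w hz hw]
        have h1 : h.j w ∈ (Set.range (g.comp h).j)ᶜ := fun ⟨y, hy⟩ => hz ⟨y, h.j.injective hy⟩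
        rw [Hom.comp_ζ_of_notMem f (g.comp h) t _ h1 hv', Hom.comp_ζ_of_mem g h t w hz h1]
    · have h1 : v ∈ (Set.range (g.comp h).j)ᶜ := fun ⟨y, hy⟩ => hz ⟨g.j y, hy⟩
      rw [Hom.comp_ζ_of_notMem _ h t v hz hv, Hom.comp_ζ_of_notMem f (g.comp h) t v h1 hv',
        Hom.comp_ζ_of_notMem g h t v hz h1]

/-- The morphisms `(i, j, ζ)` with `ζ` a bijection. -/
def bij (T : Type) : MorphismProperty (Walled.{u} T) := fun _ _ f => Function.Bijective f.ζ

theorem bij_iff {P Q : Walled.{u} T} (f : P ⟶ Q) :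
    bij T f ↔ ∀ x, x ∈ Set.range f.i ∨ ∃ p, (f.ζ p).1 = x := by
  refine ⟨fun h x => ?_, fun h => ⟨f.ζ.injective, fun ⟨x, hx⟩ => ?_⟩⟩
  · by_cases hx : x ∈ Set.range f.i
    · exact Or.inl hx
    · obtain ⟨p, hp⟩ := h.2 ⟨x, hx⟩
      exact Or.inr ⟨p, by rw [hp]⟩
  · rcases h x with h | ⟨p, hp⟩
    · exact (hx h).elim
    · exact ⟨p, Subtype.ext hp⟩

theorem bij_comp_iff {P Q R : Walled.{u} T} (f : P ⟶ Q) (g : Q ⟶ R) :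
    bij T (f ≫ g) ↔ bij T f ∧ bij T g := by
  simp only [bij_iff]
  constructor
  · intro H
    refine ⟨fun x => ?_, fun x => ?_⟩
    · rcases H (g.i x) with ⟨y, hy⟩ | ⟨⟨t, z, hz⟩, hp⟩
      · exact Or.inl ⟨y, g.i.injective hy⟩
      · rcases Hom.compl_cases f g hz with ⟨v, hv, rfl⟩ | hz'
        · right
          refine ⟨(t, ⟨v, hv⟩), g.i.injective ?_⟩
          rw [← hp]
          exact (Hom.comp_ζ_of_mem f g t v hv hz).symm
        · exact (g.ζ_ne (t, ⟨z, hz'⟩) x (hp.symm.trans (Hom.comp_ζ_of_notMem f g t z hz' hz))).elim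
    · rcases H x with ⟨y, hy⟩ | ⟨⟨t, z, hz⟩, hp⟩
      · exact Or.inl ⟨f.i y, hy⟩
      · rcases Hom.compl_cases f g hz with ⟨v, hv, rfl⟩ | hz'
        · exact Or.inl ⟨_, (Hom.comp_ζ_of_mem f g t v hv hz).symm.trans hp⟩
        · exact Or.inr ⟨(t, ⟨z, hz'⟩), (Hom.comp_ζ_of_notMem f g t z hz' hz).symm.trans hp⟩
  · rintro ⟨hf, hg⟩ x
    rcases hg x with ⟨y, rfl⟩ | ⟨⟨t, z, hz⟩, rfl⟩
    · rcases hf y with ⟨w, rfl⟩ | ⟨⟨t, v, hv⟩, rfl⟩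
      · exact Or.inl ⟨w, rfl⟩
      · refine Or.inr ⟨(t, ⟨g.j v, fun ⟨y, hy⟩ => hv ⟨y, g.j.injective hy⟩⟩), ?_⟩
        exact Hom.comp_ζ_of_mem f g t v hv _
    · refine Or.inr ⟨(t, ⟨z, fun ⟨y, hy⟩ => hz ⟨f.j y, hy⟩⟩), ?_⟩
      exact Hom.comp_ζ_of_notMem f g t z hz _

instance : (bij.{u} T).IsMultiplicative where
  id_mem _ := (bij_iff _).2 fun x => Or.inl ⟨x, rfl⟩
  comp_mem f g hf hg := (bij_comp_iff f g).2 ⟨hf, hg⟩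

/-- The wide subcategory of morphisms `(i, j, ζ)` with `ζ` a bijection. -/
abbrev Zero (T : Type) := WideSubcategory (bij.{u} T)

variable {M : Type*} [Category* M] [Limits.HasZeroMorphisms M]

open Classical in
/-- Extension by zero of a functor from the wide subcategory to the whole category. -/
noncomputable def extZeroObj (F : Zero.{u} T ⥤ M) : Walled.{u} T ⥤ M where
  obj P := F.obj ⟨P⟩
  map {P Q} f := if h : bij T f then F.map (X := ⟨P⟩) (Y := ⟨Q⟩) ⟨f, h⟩ else 0
  map_id P := by
    rw [dif_pos ((bij T).id_mem P)]
    exact F.map_id ⟨P⟩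
  map_comp {P Q R} f g := by
    by_cases h : bij T f ∧ bij T g
    · rw [dif_pos ((bij_comp_iff f g).2 h), dif_pos h.1, dif_pos h.2, ← F.map_comp]
      rfl
    · rw [dif_neg (mt (bij_comp_iff f g).1 h)]
      rcases not_and_or.1 h with h | h <;> simp [dif_neg h]

theorem extZeroObj_map_pos (F : Zero.{u} T ⥤ M) {P Q : Walled.{u} T} (f : P ⟶ Q) (h : bij T f) :
    (extZeroObj F).map f = F.map (X := ⟨P⟩) (Y := ⟨Q⟩) ⟨f, h⟩ := dif_pos h

theorem extZeroObj_map_neg (F : Zero.{u} T ⥤ M) {P Q : Walled.{u} T} (f : P ⟶ Q)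
    (h : ¬ bij T f) : (extZeroObj F).map f = 0 := dif_neg h

/-- Extension by zero as a functor between functor categories. -/
noncomputable def extZero (T : Type) (M : Type*) [Category* M] [Limits.HasZeroMorphisms M] :
    (Zero.{u} T ⥤ M) ⥤ (Walled.{u} T ⥤ M) where
  obj F := extZeroObj F
  map {F G} η :=
    { app := fun P => η.app ⟨P⟩
      naturality := fun P Q f => by
        by_cases h : bij T f
        · rw [extZeroObj_map_pos F f h, extZeroObj_map_pos G f h]
          exact η.naturality _
        · rw [extZeroObj_map_neg F f h, extZeroObj_map_neg G f h]
          exact Limits.zero_comp.trans Limits.comp_zero.symm }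

end Walled

section Modules

variable {k : Type u} [CommRing k] {A : Type*} [Category* A]

/-- The quotient of a functor to `k`-modules by a stable family of submodules. -/
def quotFun (F : A ⥤ ModuleCat.{u} k) (N : ∀ a, Submodule k (F.obj a))
    (hN : ∀ {a b} (f : a ⟶ b), N a ≤ (N b).comap (F.map f).hom) : A ⥤ ModuleCat.{u} k where
  obj a := ModuleCat.of k (F.obj a ⧸ N a)
  map {a b} f := ModuleCat.ofHom ((N a).mapQ (N b) (F.map f).hom (hN f))
  map_id a := by
    ext x
    simp
  map_comp f g := by
    ext x
    simp

/-- The projection to the quotient functor. -/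
def quotProj (F : A ⥤ ModuleCat.{u} k) (N : ∀ a, Submodule k (F.obj a))
    (hN : ∀ {a b} (f : a ⟶ b), N a ≤ (N b).comap (F.map f).hom) : F ⟶ quotFun F N hN where
  app a := ModuleCat.ofHom (N a).mkQ
  naturality _ _ _ := rfl

/-- Natural transformations out of a quotient functor. -/
def quotHomEquiv (F : A ⥤ ModuleCat.{u} k) (N : ∀ a, Submodule k (F.obj a))
    (hN : ∀ {a b} (f : a ⟶ b), N a ≤ (N b).comap (F.map f).hom) (G : A ⥤ ModuleCat.{u} k) :
    (quotFun F N hN ⟶ G) ≃ {η : F ⟶ G // ∀ a, N a ≤ LinearMap.ker (η.app a).hom} where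
  toFun η := ⟨quotProj F N hN ≫ η, fun a x hx => by
    have h : (N a).mkQ x = 0 := (Submodule.Quotient.mk_eq_zero _).2 hx
    change (η.app a).hom ((N a).mkQ x) = 0
    rw [h]
    exact map_zero (η.app a).hom⟩
  invFun η :=
    { app := fun a => ModuleCat.ofHom ((N a).liftQ (η.1.app a).hom (η.2 a))
      naturality := fun a b f => by
        ext x
        obtain ⟨x, rfl⟩ := (N a).mkQ_surjective x
        exact congrArg (fun h => h.hom x) (η.1.naturality f) }
  left_inv η := by
    ext a x
    obtain ⟨x, rfl⟩ := (N a).mkQ_surjective x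
    rfl
  right_inv η := rfl

end Modules

namespace Walled

variable {T : Type} {k : Type u} [CommRing k]

/-- The submodule spanned by the images of the morphisms `(i, j, ζ)` with `ζ` not bijective. -/
def decSub (F : Walled.{u} T ⥤ ModuleCat.{u} k) (P : Zero.{u} T) : Submodule k (F.obj P.obj) :=
  Submodule.span k {y | ∃ (Q : Walled.{u} T) (f : Q ⟶ P.obj) (x : F.obj Q),
    ¬ bij T f ∧ (F.map f).hom x = y}

theorem decSub_le (F : Walled.{u} T ⥤ ModuleCat.{u} k) {P Q : Zero.{u} T} (g : P ⟶ Q) :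
    decSub F P ≤ (decSub F Q).comap ((wideSubcategoryInclusion _ ⋙ F).map g).hom := by
  refine Submodule.span_le.2 ?_
  rintro _ ⟨R, f, x, hf, rfl⟩
  refine Submodule.subset_span ⟨R, f ≫ g.hom, x, fun h => hf ((bij_comp_iff _ _).1 h).1, ?_⟩
  rw [F.map_comp]
  rfl

/-- The quotient of a functor by the images of all morphisms outside the wide subcategory. -/
noncomputable def indec (F : Walled.{u} T ⥤ ModuleCat.{u} k) : Zero.{u} T ⥤ ModuleCat.{u} k :=
  quotFun (wideSubcategoryInclusion _ ⋙ F) (decSub F) (decSub_le F)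

theorem decSub_le_ker {F : Walled.{u} T ⥤ ModuleCat.{u} k} {G : Zero.{u} T ⥤ ModuleCat.{u} k}
    (η : F ⟶ (extZero T (ModuleCat.{u} k)).obj G) (P : Zero.{u} T) :
    decSub F P ≤ LinearMap.ker (η.app P.obj).hom := by
  refine Submodule.span_le.2 ?_
  rintro _ ⟨R, f, x, hf, rfl⟩
  have h := congrArg (fun h => h.hom x) (η.naturality f)
  have h0 : ((extZero T (ModuleCat.{u} k)).obj G).map f = 0 := extZeroObj_map_neg G f hf
  rw [h0] at h
  exact h

/-- The universal property of `indec`. -/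
noncomputable def indecEquiv (F : Walled.{u} T ⥤ ModuleCat.{u} k) (G : Zero.{u} T ⥤ ModuleCat.{u} k) :
    (indec F ⟶ G) ≃ (F ⟶ (extZero T (ModuleCat.{u} k)).obj G) :=
  (quotHomEquiv _ _ _ G).trans
    { toFun := fun η =>
        { app := fun P => η.1.app ⟨P⟩
          naturality := fun P Q f => by
            by_cases h : bij T f
            · have h0 : ((extZero T (ModuleCat.{u} k)).obj G).map f = _ := extZeroObj_map_pos G f h
              rw [h0]
              exact η.1.naturality (X := ⟨P⟩) (Y := ⟨Q⟩) ⟨f, h⟩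
            · have h0 : ((extZero T (ModuleCat.{u} k)).obj G).map f = 0 := extZeroObj_map_neg G f h
              rw [h0]
              ext x
              have hx : (F.map f).hom x ∈ decSub F ⟨Q⟩ :=
                Submodule.subset_span ⟨P, f, x, h, rfl⟩
              exact η.2 ⟨Q⟩ hx }
      invFun := fun η => ⟨
        { app := fun P => η.app P.obj
          naturality := fun P Q f => by
            have h0 : ((extZero T (ModuleCat.{u} k)).obj G).map f.hom = _ :=
              extZeroObj_map_pos G f.hom f.property
            have := η.naturality f.hom
            rw [h0] at this
            exact this }, decSub_le_ker η⟩
      left_inv := fun _ => rfl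
      right_inv := fun _ => rfl }

theorem indecEquiv_comp (F : Walled.{u} T ⥤ ModuleCat.{u} k) (G G' : Zero.{u} T ⥤ ModuleCat.{u} k)
    (g : G ⟶ G') (h : indec F ⟶ G) :
    indecEquiv F G' (h ≫ g) = indecEquiv F G h ≫ (extZero T (ModuleCat.{u} k)).map g := rfl

/-- `indec` is left adjoint to extension by zero. -/
noncomputable def indecAdj (T : Type) (k : Type u) [CommRing k] :
    Adjunction.leftAdjointOfEquiv (G := extZero T (ModuleCat.{u} k)) indecEquiv
      (fun _ _ _ _ _ => rfl) ⊣ extZero T (ModuleCat.{u} k) :=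
  Adjunction.adjunctionOfEquivLeft _ _

instance : (extZero.{u} T (ModuleCat.{u} k)).IsRightAdjoint := (indecAdj T k).isRightAdjoint

end Walled

noncomputable section

abbrev CatC := Walled.{u} Unit
abbrev CatC0 := Walled.Zero.{u} Unit
abbrev CatD := Walled.{u} (Fin 2)
abbrev CatD0 := Walled.Zero.{u} (Fin 2)

namespace CatD

/-- `(X ⨿ 𝟐, Y ⨿ 𝟏)`. -/
def addPair (P : CatD.{u}) : CatD.{u} := ⟨P.X ⊕ Fin 2, P.Y ⊕ Unit⟩

/-- The morphism `(X, Y) ⟶ (X ⨿ 𝟐, Y ⨿ 𝟏)` given by the canonical inclusions and by a permutation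
`e` of `𝟐`, seen as a bijection `𝟐 × 𝟏 ≅ 𝟐`. -/
def insertPair (e : Equiv.Perm (Fin 2)) (P : CatD.{u}) : P ⟶ P.addPair where
  i := .inl
  j := .inl
  ζ := ⟨fun p => ⟨Sum.inr (e p.1), by rintro ⟨x, hx⟩; cases hx⟩, by
    rintro ⟨t, v, hv⟩ ⟨t', v', hv'⟩ h
    have h := congrArg Subtype.val h
    obtain rfl : t = t' := e.injective (Sum.inr_injective h)
    rcases v with v | v
    · exact (hv ⟨v, rfl⟩).elim
    rcases v' with v' | v'
    · exact (hv' ⟨v', rfl⟩).elim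
    rfl⟩

/-- The morphism `ι`. -/
def iota (P : CatD.{u}) : P ⟶ P.addPair := insertPair 1 P

/-- The morphism `τ`, obtained from `ι` by exchanging the two elements of `𝟐`. -/
def tau (P : CatD.{u}) : P ⟶ P.addPair := insertPair (Equiv.swap 0 1) P

theorem bij_insertPair (e : Equiv.Perm (Fin 2)) (P : CatD.{u}) :
    Walled.bij (Fin 2) (insertPair e P) := by
  refine (Walled.bij_iff _).2 fun x => ?_
  rcases x with x | t
  · exact Or.inl ⟨x, rfl⟩
  · refine Or.inr ⟨(e.symm t, ⟨Sum.inr (), ?_⟩), ?_⟩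
    · rintro ⟨y, hy⟩
      cases hy
    · exact congrArg Sum.inr (e.apply_symm_apply t)

end CatD

section Signed

variable (k : Type u) [CommRing k]

/-- The two-sided ideal of the `k`-linear category `k𝔇` generated by the `ι + τ`. -/
def antiIdeal (P Q : Free k CatD.{u}) : Submodule k (P ⟶ Q) :=
  Submodule.span k {h | ∃ (R : CatD.{u}) (a : P ⟶ (Free.embedding k CatD.{u}).obj R)
    (b : (Free.embedding k CatD.{u}).obj R.addPair ⟶ Q),
    a ≫ ((Free.embedding k CatD.{u}).map R.iota + (Free.embedding k CatD.{u}).map R.tau) ≫ b = h}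

theorem antiIdeal_precomp {P Q R : Free k CatD.{u}} (a : P ⟶ Q) {f : Q ⟶ R}
    (hf : f ∈ antiIdeal k Q R) : a ≫ f ∈ antiIdeal k P R := by
  have : antiIdeal k Q R ≤ (antiIdeal k P R).comap (Linear.leftComp k R a) := by
    refine Submodule.span_le.2 ?_
    rintro _ ⟨S, b, c, rfl⟩
    exact Submodule.subset_span ⟨S, a ≫ b, c, by simp⟩
  exact this hf

theorem antiIdeal_postcomp {P Q R : Free k CatD.{u}} (a : Q ⟶ R) {f : P ⟶ Q}
    (hf : f ∈ antiIdeal k P Q) : f ≫ a ∈ antiIdeal k P R := by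
  have : antiIdeal k P Q ≤ (antiIdeal k P R).comap (Linear.rightComp k P a) := by
    refine Submodule.span_le.2 ?_
    rintro _ ⟨S, b, c, rfl⟩
    exact Submodule.subset_span ⟨S, b, c ≫ a, by simp⟩
  exact this hf

/-- Congruence modulo the ideal generated by the `ι + τ`. -/
def antiRel : HomRel (Free k CatD.{u}) := fun P Q f g => f - g ∈ antiIdeal k P Q

instance : Congruence (antiRel k) where
  equivalence :=
    ⟨fun f => by simp [antiRel], fun {f g} h => by
      have := (antiIdeal k _ _).neg_mem h
      rwa [neg_sub] at this, fun {f g h} h1 h2 => by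
      have := (antiIdeal k _ _).add_mem h1 h2
      rwa [sub_add_sub_cancel] at this⟩
  comp_left a _ _ h := by
    have := antiIdeal_precomp k a h
    rwa [Preadditive.comp_sub] at this
  comp_right a h := by
    have := antiIdeal_postcomp k a h
    rwa [Preadditive.sub_comp] at this

theorem antiRel_add ⦃P Q : Free k CatD.{u}⦄ (f₁ f₂ g₁ g₂ : P ⟶ Q) (hf : antiRel k f₁ f₂)
    (hg : antiRel k g₁ g₂) : antiRel k (f₁ + g₁) (f₂ + g₂) := by
  have := (antiIdeal k _ _).add_mem hf hg
  rwa [← add_sub_add_comm] at this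

theorem antiRel_smul (a : k) ⦃P Q : Free k CatD.{u}⦄ (f₁ f₂ : P ⟶ Q) (hf : antiRel k f₁ f₂) :
    antiRel k (a • f₁) (a • f₂) := by
  have := (antiIdeal k _ _).smul_mem a hf
  rwa [smul_sub] at this

/-- The `k`-linear category `𝔈`, the quotient of `k𝔇` by the ideal generated by the `ι + τ`. -/
abbrev CatE := CategoryTheory.Quotient (antiRel k)

instance : Preadditive (CatE k) := CategoryTheory.Quotient.preadditive _ (antiRel_add k)

instance : (CategoryTheory.Quotient.functor (antiRel k)).Additive := CategoryTheory.Quotient.functor_additive _ (antiRel_add k)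

instance : Linear k (CatE k) := CategoryTheory.Quotient.linear k _ (antiRel_smul k)

instance : (CategoryTheory.Quotient.functor (antiRel k)).Linear k := CategoryTheory.Quotient.linear_functor k _ (antiRel_smul k)

/-- The canonical functor `𝔇 ⥤ 𝔈`. -/
def toE : CatD.{u} ⥤ CatE k := Free.embedding k CatD.{u} ⋙ CategoryTheory.Quotient.functor (antiRel k)

/-- The canonical `k`-linear functor `k𝔇₀ ⥤ 𝔈`. -/
def freeToE : Free k CatD0.{u} ⥤ CatE k := Free.lift k (wideSubcategoryInclusion _ ⋙ toE k)

instance : (freeToE k).Additive := Free.lift_additive k _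

instance : (freeToE k).Linear k := Free.lift_linear k _

/-- The wide subcategory `𝔈₀` of `𝔈`, the image of `k𝔇₀`: its objects are those of `𝔇₀`. -/
structure CatE0 (k : Type u) [CommRing k] : Type (u + 1) where
  obj : CatD0.{u}

/-- The image of `k𝔇₀(P, Q)` in `𝔈(P, Q)`. -/
def CatE0.homSub (P Q : CatD0.{u}) : Submodule k ((toE k).obj P.obj ⟶ (toE k).obj Q.obj) :=
  LinearMap.range ((freeToE k).mapLinearMap k : (Free.of k P ⟶ Free.of k Q) →ₗ[k] _)

instance : Category (CatE0 k) where
  Hom P Q := CatE0.homSub k P.obj Q.obj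
  id P := ⟨𝟙 _, 𝟙 (Free.of k P.obj), (freeToE k).map_id _⟩
  comp {P Q R} f g := ⟨f.1 ≫ g.1, by
    obtain ⟨_, a, rfl⟩ := f
    obtain ⟨_, b, rfl⟩ := g
    exact ⟨a ≫ b, (freeToE k).map_comp a b⟩⟩
  id_comp f := Subtype.ext (Category.id_comp f.1)
  comp_id f := Subtype.ext (Category.comp_id f.1)
  assoc f g h := Subtype.ext (Category.assoc f.1 g.1 h.1)

instance : Preadditive (CatE0 k) where
  homGroup P Q := inferInstanceAs (AddCommGroup (CatE0.homSub k P.obj Q.obj))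
  add_comp _ _ _ f f' g := Subtype.ext (Preadditive.add_comp _ _ _ f.1 f'.1 g.1)
  comp_add _ _ _ f g g' := Subtype.ext (Preadditive.comp_add _ _ _ f.1 g.1 g'.1)

instance : Linear k (CatE0 k) where
  homModule P Q := inferInstanceAs (Module k (CatE0.homSub k P.obj Q.obj))
  smul_comp _ _ _ r f g := Subtype.ext (Linear.smul_comp _ _ _ r f.1 g.1)
  comp_smul _ _ _ f r g := Subtype.ext (Linear.comp_smul _ _ _ f.1 r g.1)

/-- The inclusion `𝔈₀ ⥤ 𝔈`. -/
def inclE : CatE0 k ⥤ CatE k where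
  obj P := (toE k).obj P.obj.obj
  map f := f.1

instance : (inclE k).Additive where
  map_add := rfl

instance : (inclE k).Linear k where
  map_smul _ _ := rfl

/-- The canonical functor `𝔇₀ ⥤ 𝔈₀`. -/
def toE0 : CatD0.{u} ⥤ CatE0 k where
  obj P := ⟨P⟩
  map {P Q} f := ⟨(toE k).map f.hom, (Free.embedding k CatD0.{u}).map f, by
    have := Free.lift_map_single k (wideSubcategoryInclusion _ ⋙ toE k) f 1
    rw [one_smul] at this
    exact this⟩
  map_id P := Subtype.ext ((toE k).map_id P.obj)
  map_comp f g := Subtype.ext ((toE k).map_comp f.hom g.hom)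

/-- The property of a functor to `k`-modules of being `k`-linear. -/
def linearFunctors (A : Type*) [Category* A] [Preadditive A] [Linear k A] :
    ObjectProperty (A ⥤ ModuleCat.{u} k) := fun F => F.Additive ∧ F.Linear k

/-- The category of `k`-linear functors from `A` to `k`-modules. -/
abbrev LinMod (A : Type*) [Category* A] [Preadditive A] [Linear k A] :=
  (linearFunctors k A).FullSubcategory

/-- Restriction along `𝔇 ⥤ 𝔈`, identifying `𝔈`-modules with certain functors on `𝔇`. -/
def resE : LinMod k (CatE k) ⥤ (CatD.{u} ⥤ ModuleCat.{u} k) :=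
  (linearFunctors k (CatE k)).ι ⋙ (Functor.whiskeringLeft _ _ _).obj (toE k)

/-- Restriction along `𝔇₀ ⥤ 𝔈₀`, identifying `𝔈₀`-modules with certain functors on `𝔇₀`. -/
def resE0 : LinMod k (CatE0 k) ⥤ (CatD0.{u} ⥤ ModuleCat.{u} k) :=
  (linearFunctors k (CatE0 k)).ι ⋙ (Functor.whiskeringLeft _ _ _).obj (toE0 k)

end Signed

end

noncomputable section

section Signed

variable (k : Type u) [CommRing k]

theorem free_naturality {A : Type (u + 1)} [Category.{u} A] {F G : Free k A ⥤ ModuleCat.{u} k}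
    [F.Additive] [F.Linear k] [G.Additive] [G.Linear k]
    (app : ∀ P : A, F.obj (Free.of k P) ⟶ G.obj (Free.of k P))
    (h : ∀ {P Q : A} (f : P ⟶ Q), F.map ((Free.embedding k A).map f) ≫ app Q =
      app P ≫ G.map ((Free.embedding k A).map f))
    {P Q : A} (f : Free.of k P ⟶ Free.of k Q) : F.map f ≫ app Q = app P ≫ G.map f := by
  have hF : ∀ g : (P ⟶ Q) →₀ k, F.map (X := Free.of k P) (Y := Free.of k Q) g ≫ app Q =
      app P ≫ G.map (X := Free.of k P) (Y := Free.of k Q) g := by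
    intro g
    induction g using Finsupp.induction_linear with
    | zero =>
      have h1 : F.map (0 : Free.of k P ⟶ Free.of k Q) = 0 := F.map_zero _ _
      have h2 : G.map (0 : Free.of k P ⟶ Free.of k Q) = 0 := G.map_zero _ _
      exact (congrArg (· ≫ app Q) h1).trans
        (Limits.zero_comp.trans (Limits.comp_zero.symm.trans (congrArg (app P ≫ ·) h2).symm))
    | add a b ha hb =>
      have h1 := F.map_add (X := Free.of k P) (Y := Free.of k Q) (f := a) (g := b)
      have h2 := G.map_add (X := Free.of k P) (Y := Free.of k Q) (f := a) (g := b)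
      refine (congrArg (· ≫ app Q) h1).trans (Eq.trans ?_ (congrArg (app P ≫ ·) h2).symm)
      refine (Preadditive.add_comp _ _ _ _ _ _).trans (Eq.trans ?_
        (Preadditive.comp_add _ _ _ _ _ _).symm)
      exact congrArg₂ (· + ·) ha hb
    | single a r =>
      have h0 : (Finsupp.single a r : (P ⟶ Q) →₀ k) = r • Finsupp.single a 1 := by simp
      have h1 := F.map_smul r ((Free.embedding k A).map a)
      have h2 := G.map_smul r ((Free.embedding k A).map a)
      rw [h0]
      refine (congrArg (· ≫ app Q) h1).trans (Eq.trans ?_ (congrArg (app P ≫ ·) h2).symm)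
      refine (Linear.smul_comp _ _ _ _ _ _).trans (Eq.trans ?_
        (Linear.comp_smul _ _ _ _ _ _).symm)
      exact congrArg (r • ·) (h a)
  exact hF f

/-- The canonical full functor `k𝔇₀ ⥤ 𝔈₀`. -/
def freeToE0 : Free k CatD0.{u} ⥤ CatE0 k where
  obj P := ⟨P⟩
  map a := ⟨(freeToE k).map a, a, rfl⟩
  map_id P := Subtype.ext ((freeToE k).map_id P)
  map_comp f g := Subtype.ext ((freeToE k).map_comp f g)

instance : (freeToE0 k).Additive where
  map_add := Subtype.ext ((freeToE k).map_add)

instance : (freeToE0 k).Linear k where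
  map_smul f r := Subtype.ext ((freeToE k).map_smul r f)

theorem freeToE0_map_embedding {P Q : CatD0.{u}} (f : P ⟶ Q) :
    (freeToE0 k).map ((Free.embedding k CatD0.{u}).map f) = (toE0 k).map f := by
  refine Subtype.ext ?_
  have := Free.lift_map_single k (wideSubcategoryInclusion _ ⋙ toE k) f 1
  rw [one_smul] at this
  exact this

/-- `𝔈`-modules form a full subcategory of the functors on `𝔇`. -/
def resEFullyFaithful : (resE k).FullyFaithful where
  preimage {F G} η := ObjectProperty.homMk <| CategoryTheory.Quotient.natTransLift (antiRel k)
    { app := fun P => η.app P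
      naturality := fun P Q f => by
        have := F.property.1
        have := F.property.2
        have := G.property.1
        have := G.property.2
        exact free_naturality k (F := CategoryTheory.Quotient.functor (antiRel k) ⋙ F.obj)
          (G := CategoryTheory.Quotient.functor (antiRel k) ⋙ G.obj) (fun P => η.app P)
          (fun f => η.naturality f) f }
  map_preimage _ := rfl
  preimage_map _ := rfl

/-- `𝔈₀`-modules form a full subcategory of the functors on `𝔇₀`. -/
def resE0FullyFaithful : (resE0 k).FullyFaithful where
  preimage {F G} η := ObjectProperty.homMk
    { app := fun P => η.app P.obj
      naturality := fun P Q f => by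
        have := F.property.1
        have := F.property.2
        have := G.property.1
        have := G.property.2
        obtain ⟨_, a, rfl⟩ := f
        refine free_naturality k (F := freeToE0 k ⋙ F.obj)
          (G := freeToE0 k ⋙ G.obj) (fun P => η.app P) (fun f => ?_) a
        have h := η.naturality f
        have e := freeToE0_map_embedding k f
        exact (congrArg (fun m => F.obj.map m ≫ η.app _) e).trans
          (h.trans (congrArg (fun m => η.app _ ≫ G.obj.map m) e).symm) }
  map_preimage _ := rfl
  preimage_map _ := rfl

variable {k}

/-- The `𝔈`-module given by a functor `F` on `𝔇` such that `F(ι) = - F(τ)`. -/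
def liftE (F : CatD.{u} ⥤ ModuleCat.{u} k)
    (hF : ∀ P : CatD.{u}, F.map P.iota + F.map P.tau = 0) : LinMod k (CatE k) where
  obj := CategoryTheory.Quotient.lift (antiRel k) (Free.lift k F) fun P Q f g h => by
    have hle : antiIdeal k P Q ≤ LinearMap.ker ((Free.lift k F).mapLinearMap k) := by
      refine Submodule.span_le.2 ?_
      rintro _ ⟨R, a, b, rfl⟩
      have h1 : (Free.lift k F).map ((Free.embedding k CatD.{u}).map R.iota +
          (Free.embedding k CatD.{u}).map R.tau) = 0 := by
        refine (Free.lift k F).map_add.trans ?_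
        have e1 := Free.lift_map_single k F R.iota 1
        have e2 := Free.lift_map_single k F R.tau 1
        rw [one_smul] at e1 e2
        exact (congrArg₂ (· + ·) e1 e2).trans (hF R)
      change (Free.lift k F).map _ = 0
      rw [Functor.map_comp, Functor.map_comp, h1, Limits.zero_comp, Limits.comp_zero]
    have h2 : (Free.lift k F).map (f - g) = 0 := hle h
    rw [Functor.map_sub] at h2
    exact sub_eq_zero.1 h2
  property := by
    constructor
    · constructor
      rintro P Q ⟨f⟩ ⟨g⟩
      exact (Free.lift k F).map_add
    · constructor
      rintro P Q ⟨f⟩ r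
      exact (Free.lift k F).map_smul r f

theorem liftE_map (F : CatD.{u} ⥤ ModuleCat.{u} k)
    (hF : ∀ P : CatD.{u}, F.map P.iota + F.map P.tau = 0) {P Q : CatD.{u}} (f : P ⟶ Q) :
    (((resE k).obj (liftE F hF)).map f : F.obj P ⟶ F.obj Q) = F.map f := by
  have e1 := Free.lift_map_single k F f 1
  rw [one_smul] at e1
  exact e1

/-- Restricting `liftE F` to `𝔇` gives back `F`. -/
def resLiftE (F : CatD.{u} ⥤ ModuleCat.{u} k)
    (hF : ∀ P : CatD.{u}, F.map P.iota + F.map P.tau = 0) : (resE k).obj (liftE F hF) ≅ F :=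
  NatIso.ofComponents (fun P => Iso.refl (F.obj P)) fun f => by
    have := liftE_map F hF f
    exact (Category.comp_id _).trans (this.trans (Category.id_comp _).symm)

variable (k) in
theorem toE_iota_add_tau (P : CatD.{u}) : (toE k).map P.iota + (toE k).map P.tau = 0 := by
  have h : antiRel k ((Free.embedding k CatD.{u}).map P.iota + (Free.embedding k CatD.{u}).map P.tau)
      0 := by
    refine Submodule.subset_span ⟨P, 𝟙 _, 𝟙 _, ?_⟩
    rw [Category.id_comp, Category.comp_id, sub_zero]
  exact CategoryTheory.Quotient.sound _ h

/-- `ι` and `τ` as morphisms of `𝔇₀`. -/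
def insertPair0 (e : Equiv.Perm (Fin 2)) (P : CatD0.{u}) :
    P ⟶ (⟨CatD.addPair P.obj⟩ : CatD0.{u}) :=
  ⟨CatD.insertPair e P.obj, CatD.bij_insertPair e P.obj⟩

theorem resE_anti (F : LinMod k (CatE k)) (P : CatD.{u}) :
    ((resE k).obj F).map P.iota + ((resE k).obj F).map P.tau = 0 := by
  have := F.property.1
  have h := congrArg F.obj.map (toE_iota_add_tau k P)
  rw [F.obj.map_add, F.obj.map_zero] at h
  exact h

theorem resE0_anti (F : LinMod k (CatE0 k)) (P : CatD0.{u}) :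
    ((resE0 k).obj F).map (insertPair0 1 P) +
      ((resE0 k).obj F).map (insertPair0 (Equiv.swap 0 1) P) = 0 := by
  have := F.property.1
  have h0 : (toE0 k).map (insertPair0 1 P) + (toE0 k).map (insertPair0 (Equiv.swap 0 1) P) = 0 :=
    Subtype.ext (toE_iota_add_tau k P.obj)
  have h := congrArg F.obj.map h0
  rw [F.obj.map_add, F.obj.map_zero] at h
  exact h

theorem extZero_anti (F : CatD0.{u} ⥤ ModuleCat.{u} k)
    (hF : ∀ P : CatD0.{u}, F.map (insertPair0 1 P) + F.map (insertPair0 (Equiv.swap 0 1) P) = 0)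
    (P : CatD.{u}) : ((Walled.extZero (Fin 2) (ModuleCat.{u} k)).obj F).map P.iota +
      ((Walled.extZero (Fin 2) (ModuleCat.{u} k)).obj F).map P.tau = 0 := by
  have h1 := Walled.extZeroObj_map_pos F P.iota (CatD.bij_insertPair _ P)
  have h2 := Walled.extZeroObj_map_pos F P.tau (CatD.bij_insertPair _ P)
  exact (congrArg₂ (· + ·) h1 h2).trans (hF ⟨P⟩)

/-- The `𝔈₀`-module given by a functor `F` on `𝔇₀` such that `F(ι) = - F(τ)`. -/
def liftE0 (F : CatD0.{u} ⥤ ModuleCat.{u} k)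
    (hF : ∀ P : CatD0.{u}, F.map (insertPair0 1 P) + F.map (insertPair0 (Equiv.swap 0 1) P) = 0) :
    LinMod k (CatE0 k) where
  obj := inclE k ⋙ (liftE _ (extZero_anti F hF)).obj
  property := by
    have := (liftE _ (extZero_anti F hF)).property.1
    have := (liftE _ (extZero_anti F hF)).property.2
    exact ⟨inferInstance, inferInstance⟩

/-- Restricting `liftE0 F` to `𝔇₀` gives back `F`. -/
def resLiftE0 (F : CatD0.{u} ⥤ ModuleCat.{u} k)
    (hF : ∀ P : CatD0.{u}, F.map (insertPair0 1 P) + F.map (insertPair0 (Equiv.swap 0 1) P) = 0) :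
    (resE0 k).obj (liftE0 F hF) ≅ F :=
  NatIso.ofComponents (fun P => Iso.refl (F.obj P)) fun f => by
    have h1 := liftE_map _ (extZero_anti F hF) f.hom
    have h2 := Walled.extZeroObj_map_pos F f.hom f.property
    exact (Category.comp_id _).trans ((h1.trans h2).trans (Category.id_comp _).symm)

variable (k) in
/-- Extension by zero from `𝔈₀`-modules to `𝔈`-modules: a morphism of `𝔈` represented by a morphism
`f` of `𝔇` acts through its class in `𝔈₀` if `f` lies in `𝔇₀`, and by zero otherwise. -/
def extE : LinMod k (CatE0 k) ⥤ LinMod k (CatE k) where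
  obj F := liftE ((Walled.extZero _ _).obj ((resE0 k).obj F)) (extZero_anti _ (resE0_anti F))
  map {F G} η := (resEFullyFaithful k).preimage
    ((resLiftE _ (extZero_anti _ (resE0_anti F))).hom ≫
      (Walled.extZero _ _).map ((resE0 k).map η) ≫
      (resLiftE _ (extZero_anti _ (resE0_anti G))).inv)
  map_id F := (resEFullyFaithful k).map_injective (by simp)
  map_comp f g := (resEFullyFaithful k).map_injective (by simp)

/-- Extension by zero is compatible with restriction to `𝔇` and `𝔇₀`. -/
def extERes : resE0 k ⋙ Walled.extZero (Fin 2) (ModuleCat.{u} k) ≅ extE k ⋙ resE k :=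
  NatIso.ofComponents (fun F => (resLiftE _ (extZero_anti _ (resE0_anti F))).symm)
    (by simp [extE])

theorem indec_anti (F : LinMod k (CatE k)) (P : CatD0.{u}) :
    (Walled.indec ((resE k).obj F)).map (insertPair0 1 P) +
      (Walled.indec ((resE k).obj F)).map (insertPair0 (Equiv.swap 0 1) P) = 0 := by
  ext x
  obtain ⟨x, rfl⟩ := Submodule.mkQ_surjective _ x
  have h := congrArg (fun m => (Walled.decSub ((resE k).obj F) ⟨CatD.addPair P.obj⟩).mkQ (m.hom x))
    (resE_anti F P.obj)
  exact h.trans (map_zero _)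

/-- `H₀` of an `𝔈`-module. -/
def indecE (F : LinMod k (CatE k)) : LinMod k (CatE0 k) :=
  liftE0 (Walled.indec ((resE k).obj F)) (indec_anti F)

/-- The universal property of `indecE`. -/
def indecEEquiv (F : LinMod k (CatE k)) (G : LinMod k (CatE0 k)) :
    (indecE F ⟶ G) ≃ (F ⟶ (extE k).obj G) :=
  (resE0FullyFaithful k).homEquiv.trans <|
    ((resLiftE0 _ (indec_anti F)).homCongr (Iso.refl _)).trans <|
    (Walled.indecEquiv _ _).trans <|
    ((Iso.refl _).homCongr (extERes.app G)).trans <|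
    (resEFullyFaithful k).homEquiv.symm

instance : (extE k).IsRightAdjoint :=
  (Adjunction.adjunctionOfEquivLeft (G := extE k) indecEEquiv (fun F G G' g h => by
    apply (resEFullyFaithful k).map_injective
    ext P x
    rfl)).isRightAdjoint

end Signed

end

noncomputable section

section Antisymmetrization

variable {k : Type u} [CommRing k]

/-- The submodule spanned by the images of the `F(b)(F(ι) + F(τ))`. -/
def antiSub (F : CatD0.{u} ⥤ ModuleCat.{u} k) (P : CatD0.{u}) : Submodule k (F.obj P) :=
  Submodule.span k {y | ∃ (R : CatD0.{u}) (b : (⟨CatD.addPair R.obj⟩ : CatD0.{u}) ⟶ P)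
    (x : F.obj R), (F.map b).hom ((F.map (insertPair0 1 R)).hom x +
      (F.map (insertPair0 (Equiv.swap 0 1) R)).hom x) = y}

theorem antiSub_le (F : CatD0.{u} ⥤ ModuleCat.{u} k) {P Q : CatD0.{u}} (g : P ⟶ Q) :
    antiSub F P ≤ (antiSub F Q).comap (F.map g).hom := by
  refine Submodule.span_le.2 ?_
  rintro _ ⟨R, b, x, rfl⟩
  refine Submodule.subset_span ⟨R, b ≫ g, x, ?_⟩
  rw [F.map_comp]
  rfl

/-- The quotient of `F` by the relations `ι = - τ`, as a functor on `𝔇₀`. -/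
def antiQuot (F : CatD0.{u} ⥤ ModuleCat.{u} k) : CatD0.{u} ⥤ ModuleCat.{u} k :=
  quotFun F (antiSub F) (antiSub_le F)

theorem antiQuot_anti (F : CatD0.{u} ⥤ ModuleCat.{u} k) (P : CatD0.{u}) :
    (antiQuot F).map (insertPair0 1 P) +
      (antiQuot F).map (insertPair0 (Equiv.swap 0 1) P) = 0 := by
  ext x
  obtain ⟨x, rfl⟩ := Submodule.mkQ_surjective _ x
  have h : (F.map (insertPair0 1 P)).hom x + (F.map (insertPair0 (Equiv.swap 0 1) P)).hom x ∈
      antiSub F ⟨CatD.addPair P.obj⟩ := by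
    refine Submodule.subset_span ⟨P, 𝟙 _, x, ?_⟩
    rw [F.map_id]
    rfl
  exact (Submodule.Quotient.mk_eq_zero _).2 h

theorem antiSub_le_ker {F : CatD0.{u} ⥤ ModuleCat.{u} k} {G : LinMod k (CatE0 k)}
    (η : F ⟶ (resE0 k).obj G) (P : CatD0.{u}) : antiSub F P ≤ LinearMap.ker (η.app P).hom := by
  refine Submodule.span_le.2 ?_
  rintro _ ⟨R, b, x, rfl⟩
  have h (e) : (η.app _).hom ((F.map (insertPair0 e R)).hom x) =
      (((resE0 k).obj G).map (insertPair0 e R)).hom ((η.app R).hom x) :=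
    congrArg (fun m => m.hom x) (η.naturality (insertPair0 e R))
  have h0 := congrArg (fun m => m.hom ((η.app R).hom x)) (resE0_anti G R)
  have h1 := congrArg (fun m => m.hom ((F.map (insertPair0 1 R)).hom x +
      (F.map (insertPair0 (Equiv.swap 0 1) R)).hom x)) (η.naturality b)
  refine h1.trans ?_
  change (((resE0 k).obj G).map b).hom ((η.app _).hom _) = 0
  rw [map_add, h, h]
  refine (congrArg (((resE0 k).obj G).map b).hom h0).trans (map_zero _)

/-- The universal property of the antisymmetrization. -/
def antiEquiv (F : CatD0.{u} ⥤ ModuleCat.{u} k) (G : LinMod k (CatE0 k)) :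
    (liftE0 (antiQuot F) (antiQuot_anti F) ⟶ G) ≃ (F ⟶ (resE0 k).obj G) :=
  (resE0FullyFaithful k).homEquiv.trans <|
    ((resLiftE0 _ (antiQuot_anti F)).homCongr (Iso.refl _)).trans <|
    (quotHomEquiv _ _ _ _).trans <|
    Equiv.subtypeUnivEquiv fun η => antiSub_le_ker η

instance : (resE0 k).IsRightAdjoint :=
  (Adjunction.adjunctionOfEquivLeft (G := resE0 k) antiEquiv (fun F G G' g h => by
    ext P x
    rfl)).isRightAdjoint

end Antisymmetrization

section Induction

variable {k : Type u} [CommRing k]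

namespace CatD

/-- The object `(X ∖ κ(Y), Y)` of `ℭ`. -/
def ctrct (P : CatD.{u}) (κ : P.Y ↪ P.X) : CatC.{u} := ⟨↥(Set.range κ)ᶜ, P.Y⟩

open Classical in
/-- For `(i, j, ζ) : (X, Y) ⟶ (U, V)` and `κ : Y ↪ X`, the map `V → U` which is `i ∘ κ ∘ j⁻¹` on
`j(Y)` and `ζ(1, -)` on `V ∖ j(Y)`. -/
def pushFun {P Q : CatD.{u}} (f : P ⟶ Q) (κ : P.Y ↪ P.X) (v : Q.Y) : Q.X :=
  if h : v ∈ Set.range f.j then f.i (κ h.choose) else (f.ζ (0, ⟨v, h⟩)).1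

theorem pushFun_j {P Q : CatD.{u}} (f : P ⟶ Q) (κ : P.Y ↪ P.X) (y : P.Y) :
    pushFun f κ (f.j y) = f.i (κ y) := by
  have hm : f.j y ∈ Set.range f.j := ⟨y, rfl⟩
  have : hm.choose = y := f.j.injective hm.choose_spec
  simp only [pushFun, hm, dif_pos, this]

theorem pushFun_compl {P Q : CatD.{u}} (f : P ⟶ Q) (κ : P.Y ↪ P.X) (v : Q.Y)
    (hv : v ∈ (Set.range f.j)ᶜ) : pushFun f κ v = (f.ζ (0, ⟨v, hv⟩)).1 :=
  dif_neg hv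

/-- The injection `V ↪ U` induced by `κ : Y ↪ X` and a morphism `(X, Y) ⟶ (U, V)`. -/
def push {P Q : CatD.{u}} (f : P ⟶ Q) (κ : P.Y ↪ P.X) : Q.Y ↪ Q.X :=
  ⟨pushFun f κ, by
    intro v w h
    by_cases hv : v ∈ Set.range f.j <;> by_cases hw : w ∈ Set.range f.j
    · obtain ⟨v, rfl⟩ := hv
      obtain ⟨w, rfl⟩ := hw
      rw [pushFun_j, pushFun_j] at h
      rw [κ.injective (f.i.injective h)]
    · obtain ⟨v, rfl⟩ := hv
      rw [pushFun_j, pushFun_compl f κ w hw] at h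
      exact (f.ζ_ne _ _ h).elim
    · obtain ⟨w, rfl⟩ := hw
      rw [pushFun_j, pushFun_compl f κ v hv] at h
      exact (f.ζ_ne _ _ h.symm).elim
    · rw [pushFun_compl f κ v hv, pushFun_compl f κ w hw] at h
      have := f.ζ.injective (Subtype.ext h)
      simpa using this⟩

theorem push_j {P Q : CatD.{u}} (f : P ⟶ Q) (κ : P.Y ↪ P.X) (y : P.Y) :
    push f κ (f.j y) = f.i (κ y) := pushFun_j f κ y

theorem push_compl {P Q : CatD.{u}} (f : P ⟶ Q) (κ : P.Y ↪ P.X) (v : Q.Y)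
    (hv : v ∈ (Set.range f.j)ᶜ) : push f κ v = (f.ζ (0, ⟨v, hv⟩)).1 := pushFun_compl f κ v hv

theorem push_id (P : CatD.{u}) (κ : P.Y ↪ P.X) : push (𝟙 P) κ = κ :=
  DFunLike.ext _ _ fun y => push_j (𝟙 P) κ y

theorem push_comp {P Q R : CatD.{u}} (f : P ⟶ Q) (g : Q ⟶ R) (κ : P.Y ↪ P.X) :
    push (f ≫ g) κ = push g (push f κ) := by
  refine DFunLike.ext _ _ fun z => ?_
  by_cases hz : z ∈ Set.range (f ≫ g).j
  · obtain ⟨y, rfl⟩ := hz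
    refine (push_j (f ≫ g) κ y).trans (Eq.symm ?_)
    refine (push_j g (push f κ) (f.j y)).trans ?_
    rw [push_j]
    rfl
  · rw [push_compl (f ≫ g) κ z hz]
    rcases Walled.Hom.compl_cases f g hz with ⟨v, hv, rfl⟩ | hz'
    · rw [push_j, push_compl f κ v hv]
      exact Walled.Hom.comp_ζ_of_mem f g 0 v hv hz
    · rw [push_compl g _ z hz']
      exact Walled.Hom.comp_ζ_of_notMem f g 0 z hz' hz

/-- The morphism `(X ∖ κ(Y), Y) ⟶ (U ∖ κ'(V), V)` of `ℭ` induced by a morphism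
`(i, j, ζ) : (X, Y) ⟶ (U, V)` of `𝔇`, where `κ' = push κ`: it is given by the restriction of `i`,
by `j` and by `ζ(2, -)`. -/
def ctrctMap {P Q : CatD.{u}} (f : P ⟶ Q) (κ : P.Y ↪ P.X) : P.ctrct κ ⟶ Q.ctrct (push f κ) where
  i := ⟨fun x => ⟨f.i x.1, by
      rintro ⟨v, hv⟩
      by_cases h : v ∈ Set.range f.j
      · obtain ⟨y, rfl⟩ := h
        rw [push_j] at hv
        exact x.2 ⟨y, f.i.injective hv⟩
      · rw [push_compl f κ v h] at hv
        exact f.ζ_ne _ _ hv.symm⟩, fun x y h =>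
      Subtype.ext (f.i.injective (congrArg Subtype.val h))⟩
  j := f.j
  ζ := ⟨fun p => ⟨⟨(f.ζ (1, p.2)).1, by
      rintro ⟨v, hv⟩
      by_cases h : v ∈ Set.range f.j
      · obtain ⟨y, rfl⟩ := h
        rw [push_j] at hv
        exact f.ζ_ne _ _ hv
      · rw [push_compl f κ v h] at hv
        have := f.ζ.injective (Subtype.ext hv)
        have h01 : (0 : Fin 2) = 1 := congrArg Prod.fst this
        exact absurd h01 (by decide)⟩, by
      rintro ⟨x, hx⟩
      exact f.ζ_ne _ _ (congrArg Subtype.val hx)⟩, by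
    rintro ⟨⟨⟩, v⟩ ⟨⟨⟩, w⟩ h
    have := f.ζ.injective (Subtype.ext (congrArg (fun z => z.1.1) h))
    have hvw : v = w := congrArg Prod.snd this
    rw [hvw]⟩

theorem sigma_ctrct_ext {A : CatC.{u}} {Q : CatD.{u}} {κ κ' : Q.Y ↪ Q.X} (h : κ = κ')
    (m : A ⟶ Q.ctrct κ) (m' : A ⟶ Q.ctrct κ') (hi : ∀ x, (m.i x).1 = (m'.i x).1)
    (hj : ∀ y, (m.j y : Q.Y) = m'.j y)
    (hζ : ∀ t v hv hv', (m.ζ (t, ⟨v, hv⟩)).1.1 = (m'.ζ (t, ⟨v, hv'⟩)).1.1) :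
    (⟨κ, m⟩ : Σ κ, A ⟶ Q.ctrct κ) = ⟨κ', m'⟩ := by
  subst h
  congr 1
  exact Walled.Hom.ext_apply (fun x => Subtype.ext (hi x)) hj
    fun t v hv hv' => Subtype.ext (hζ t v hv hv')

theorem ctrctMap_id (P : CatD.{u}) (κ : P.Y ↪ P.X) :
    (⟨_, ctrctMap (𝟙 P) κ⟩ : Σ κ', P.ctrct κ ⟶ P.ctrct κ') = ⟨κ, 𝟙 _⟩ :=
  sigma_ctrct_ext (push_id P κ) _ _ (fun _ => rfl) (fun _ => rfl)
    fun _ v hv _ => (hv ⟨v, rfl⟩).elim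

theorem ctrctMap_comp {P Q R : CatD.{u}} (f : P ⟶ Q) (g : Q ⟶ R) (κ : P.Y ↪ P.X) :
    (⟨_, ctrctMap (f ≫ g) κ⟩ : Σ κ', P.ctrct κ ⟶ R.ctrct κ') =
      ⟨_, ctrctMap f κ ≫ ctrctMap g (push f κ)⟩ := by
  refine sigma_ctrct_ext (push_comp f g κ) _ _ (fun _ => rfl) (fun _ => rfl) ?_
  rintro ⟨⟩ z hz hz'
  rcases Walled.Hom.compl_cases f g hz with ⟨v, hv, rfl⟩ | hw
  · refine (Walled.Hom.comp_ζ_of_mem f g 1 v hv hz).trans (Eq.symm ?_)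
    exact congrArg Subtype.val (Walled.Hom.comp_ζ_of_mem (ctrctMap f κ) (ctrctMap g (push f κ))
      () v hv hz')
  · refine (Walled.Hom.comp_ζ_of_notMem f g 1 z hw hz).trans (Eq.symm ?_)
    exact congrArg Subtype.val (Walled.Hom.comp_ζ_of_notMem (ctrctMap f κ)
      (ctrctMap g (push f κ)) () z hw hz')

end CatD

open Classical in
theorem lof_eq_of_sigma_eq (F : CatC.{u} ⥤ ModuleCat.{u} k) {A : CatC.{u}} {Q : CatD.{u}}
    {p q : Σ κ, A ⟶ Q.ctrct κ} (h : p = q) (x : F.obj A) :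
    DirectSum.lof k (Q.Y ↪ Q.X) (fun κ => F.obj (Q.ctrct κ)) p.1 ((F.map p.2).hom x) =
      DirectSum.lof k (Q.Y ↪ Q.X) (fun κ => F.obj (Q.ctrct κ)) q.1 ((F.map q.2).hom x) := by
  rw [h]

open Classical in
/-- The map `⨁_κ F(X ∖ κ(Y), Y) → ⨁_κ' F(U ∖ κ'(V), V)` induced by a morphism
`(X, Y) ⟶ (U, V)`: it sends the summand indexed by `κ` to the one indexed by `push κ`. -/
def indMap (F : CatC.{u} ⥤ ModuleCat.{u} k) {P Q : CatD.{u}} (f : P ⟶ Q) :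
    (DirectSum (P.Y ↪ P.X) fun κ => F.obj (P.ctrct κ)) →ₗ[k]
      DirectSum (Q.Y ↪ Q.X) fun κ => F.obj (Q.ctrct κ) :=
  DirectSum.toModule k _ _ fun κ =>
    DirectSum.lof k (Q.Y ↪ Q.X) (fun κ' => F.obj (Q.ctrct κ')) (CatD.push f κ) ∘ₗ
      (F.map (CatD.ctrctMap f κ)).hom

open Classical in
theorem indMap_lof (F : CatC.{u} ⥤ ModuleCat.{u} k) {P Q : CatD.{u}} (f : P ⟶ Q)
    (κ : P.Y ↪ P.X) (x : F.obj (P.ctrct κ)) :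
    indMap F f (DirectSum.lof k (P.Y ↪ P.X) (fun κ => F.obj (P.ctrct κ)) κ x) =
      DirectSum.lof k (Q.Y ↪ Q.X) (fun κ => F.obj (Q.ctrct κ)) (CatD.push f κ)
        ((F.map (CatD.ctrctMap f κ)).hom x) := by
  rw [indMap, DirectSum.toModule_lof]
  rfl

/-- The functor `(U, V) ↦ ⨁_{κ : V ↪ U} F(U ∖ κ(V), V)` on `𝔇`. -/
def indObj (F : CatC.{u} ⥤ ModuleCat.{u} k) : CatD.{u} ⥤ ModuleCat.{u} k where
  obj P := ModuleCat.of k (DirectSum (P.Y ↪ P.X) fun κ => F.obj (P.ctrct κ))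
  map f := ModuleCat.ofHom (indMap F f)
  map_id P := by
    classical
    refine ModuleCat.hom_ext (DirectSum.linearMap_ext _ fun κ => LinearMap.ext fun x => ?_)
    refine (indMap_lof F _ _ _).trans ((lof_eq_of_sigma_eq F (CatD.ctrctMap_id P κ) x).trans ?_)
    dsimp only
    rw [F.map_id]
    rfl
  map_comp {P Q R} f g := by
    classical
    refine ModuleCat.hom_ext (DirectSum.linearMap_ext _ fun κ => LinearMap.ext fun x => ?_)
    refine (indMap_lof F _ _ _).trans
      ((lof_eq_of_sigma_eq F (CatD.ctrctMap_comp f g κ) x).trans ?_)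
    dsimp only
    rw [F.map_comp]
    exact ((congrArg (indMap F g) (indMap_lof F f κ x)).trans (indMap_lof F g _ _)).symm

open Classical in
/-- The map of direct sums induced by a natural transformation. -/
def indNat {F G : CatC.{u} ⥤ ModuleCat.{u} k} (η : F ⟶ G) (P : CatD.{u}) :
    (DirectSum (P.Y ↪ P.X) fun κ => F.obj (P.ctrct κ)) →ₗ[k]
      DirectSum (P.Y ↪ P.X) fun κ => G.obj (P.ctrct κ) :=
  DirectSum.toModule k _ _ fun κ =>
    DirectSum.lof k (P.Y ↪ P.X) (fun κ => G.obj (P.ctrct κ)) κ ∘ₗ (η.app (P.ctrct κ)).hom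

open Classical in
theorem indNat_lof {F G : CatC.{u} ⥤ ModuleCat.{u} k} (η : F ⟶ G) (P : CatD.{u})
    (κ : P.Y ↪ P.X) (x : F.obj (P.ctrct κ)) :
    indNat η P (DirectSum.lof k (P.Y ↪ P.X) (fun κ => F.obj (P.ctrct κ)) κ x) =
      DirectSum.lof k (P.Y ↪ P.X) (fun κ => G.obj (P.ctrct κ)) κ
        ((η.app (P.ctrct κ)).hom x) := by
  rw [indNat, DirectSum.toModule_lof]
  rfl

/-- The induction functor from functors on `ℭ` to functors on `𝔇`. -/
def ind (k : Type u) [CommRing k] :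
    (CatC.{u} ⥤ ModuleCat.{u} k) ⥤ (CatD.{u} ⥤ ModuleCat.{u} k) where
  obj F := indObj F
  map {F G} η :=
    { app := fun P => ModuleCat.ofHom (indNat η P)
      naturality := fun P Q f => by
        classical
        refine ModuleCat.hom_ext (DirectSum.linearMap_ext _ fun κ => LinearMap.ext fun x => ?_)
        refine ((congrArg (indNat η Q) (indMap_lof F f κ x)).trans (indNat_lof η Q _ _)).trans ?_
        refine Eq.trans ?_
          ((congrArg (indMap G f) (indNat_lof η P κ x)).trans (indMap_lof G f _ _)).symm
        exact congrArg (DirectSum.lof k _ _ _)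
          (congrArg (fun m => m.hom x) (η.naturality (CatD.ctrctMap f κ))) }
  map_id F := by
    classical
    ext P : 2
    exact ModuleCat.hom_ext (DirectSum.linearMap_ext _ fun κ => LinearMap.ext fun x =>
      indNat_lof _ P κ x)
  map_comp η θ := by
    classical
    ext P : 2
    refine ModuleCat.hom_ext (DirectSum.linearMap_ext _ fun κ => LinearMap.ext fun x => ?_)
    exact (indNat_lof _ P κ x).trans
      ((congrArg (indNat θ P) (indNat_lof η P κ x)).trans (indNat_lof θ P _ _)).symm

/-- The restriction of induction to functors on `ℭ₀`, viewed by extension by zero as functors on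
`ℭ`; it takes values in functors on `𝔇₀`. -/
def ind0 (k : Type u) [CommRing k] :
    (CatC0.{u} ⥤ ModuleCat.{u} k) ⥤ (CatD0.{u} ⥤ ModuleCat.{u} k) :=
  Walled.extZero Unit (ModuleCat.{u} k) ⋙ ind k ⋙
    (Functor.whiskeringLeft _ _ _).obj (wideSubcategoryInclusion _)

end Induction

end

noncomputable section

section Relations

variable (k : Type u) [CommRing k] {A B C : Type u} [Finite B] [Finite C]

open Classical in
/-- For a relation `R` between `A` and a finite set `B`, the sum of the `[b]` with `R a b`. -/
def relSum (R : A → B → Prop) (a : A) : B →₀ k :=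
  letI := Fintype.ofFinite B
  ∑ b ∈ Finset.univ.filter (R a), Finsupp.single b 1

/-- The linear map of free modules `[a] ↦ ∑_{R a b} [b]`. -/
def relMap (R : A → B → Prop) : (A →₀ k) →ₗ[k] (B →₀ k) :=
  Finsupp.linearCombination k (relSum k R)

theorem relMap_single (R : A → B → Prop) (a : A) :
    relMap k R (Finsupp.single a 1) = relSum k R a := by
  simp [relMap]

theorem relMap_id (R : B → B → Prop) (hR : ∀ a b, R a b ↔ a = b) : relMap k R = LinearMap.id := by
  classical
  let _ := Fintype.ofFinite B
  refine Finsupp.lhom_ext' fun a => LinearMap.ext_ring ?_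
  refine (relMap_single k R a).trans ?_
  have : Finset.univ.filter (R a) = {a} := by
    ext b
    simp [hR, eq_comm]
  simp [relSum, this]

theorem relMap_comp (R : A → B → Prop) (S : B → C → Prop) (U : A → C → Prop)
    (hU : ∀ a c, U a c ↔ ∃ b, R a b ∧ S b c) (hS : ∀ b b' c, S b c → S b' c → b = b') :
    relMap k U = relMap k S ∘ₗ relMap k R := by
  classical
  let _ := Fintype.ofFinite B
  let _ := Fintype.ofFinite C
  refine Finsupp.lhom_ext' fun a => LinearMap.ext_ring ?_
  refine (relMap_single k U a).trans (Eq.symm ?_)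
  refine (congrArg (relMap k S) (relMap_single k R a)).trans ?_
  have : Finset.univ.filter (U a) =
      (Finset.univ.filter (R a)).biUnion fun b => Finset.univ.filter (S b) := by
    ext c
    simp [hU]
  rw [relSum, relSum, this, map_sum, Finset.sum_biUnion]
  · exact Finset.sum_congr rfl fun b _ => relMap_single k S b
  · intro b _ b' _ hb
    refine Finset.disjoint_left.2 fun c hc hc' => hb (hS b b' c ?_ ?_)
    · simpa using hc
    · simpa using hc'

theorem relMap_add_mem (R R' : A → B → Prop) (a a' : A) (σ : B ≃ B)
    (h : ∀ b, R' a' (σ b) ↔ R a b) (N : Submodule k (B →₀ k))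
    (hN : ∀ b, R a b → Finsupp.single b 1 + Finsupp.single (σ b) 1 ∈ N) :
    relMap k R (Finsupp.single a 1) + relMap k R' (Finsupp.single a' 1) ∈ N := by
  classical
  let _ := Fintype.ofFinite B
  have h1 : relSum k R' a' = ∑ b ∈ Finset.univ.filter (R a), Finsupp.single (σ b) 1 := by
    refine (Finset.sum_equiv σ (fun b => ?_) fun b _ => rfl).symm
    simp [h]
  rw [relMap_single, relMap_single, h1, relSum, ← Finset.sum_add_distrib]
  exact N.sum_mem fun b hb => hN b (by simpa using hb)

end Relations

section HomFI

/-- For a morphism `(i, j, α) : (X, Y) ⟶ (U, V)` of `ℭ` and injections `a : X ↪ Y`, `b : U ↪ V`: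
`b` extends `a` along `i` and `j`, and `b ∘ α` is the inclusion of `V ∖ j(Y)`. -/
def extendsInj {P Q : CatC.{u}} (f : P ⟶ Q) (a : P.X ↪ P.Y) (b : Q.X ↪ Q.Y) : Prop :=
  (∀ x, b (f.i x) = f.j (a x)) ∧ ∀ p, b (f.ζ p).1 = p.2.1

theorem extendsInj_comp {P Q R : CatC.{u}} (f : P ⟶ Q) (g : Q ⟶ R) (a : P.X ↪ P.Y)
    (c : R.X ↪ R.Y) : extendsInj (f ≫ g) a c ↔ ∃ b, extendsInj f a b ∧ extendsInj g b c := by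
  constructor
  · rintro ⟨h1, h2⟩
    have h2' : ∀ t z (hz : z ∈ (Set.range g.j)ᶜ), c (g.ζ (t, ⟨z, hz⟩)).1 = z := by
      intro t z hz
      have hz' : z ∈ (Set.range (f ≫ g).j)ᶜ := fun ⟨y, hy⟩ => hz ⟨f.j y, hy⟩
      exact (congrArg c (Walled.Hom.comp_ζ_of_notMem f g t z hz hz').symm).trans (h2 (t, ⟨z, hz'⟩))
    have hmem : ∀ x, ∃ y, g.j y = c (g.i x) := by
      intro x
      by_contra hx
      exact g.ζ_ne _ x (c.injective (h2' () (c (g.i x)) hx)).symm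
    choose b hb using hmem
    refine ⟨⟨b, fun x y h => g.i.injective (c.injective (by rw [← hb, ← hb, h]))⟩,
      ⟨fun x => g.j.injective ((hb _).trans (h1 x)), ?_⟩, fun x => (hb x).symm, ?_⟩
    · rintro ⟨t, v, hv⟩
      refine g.j.injective ((hb _).trans ?_)
      have hz' : g.j v ∈ (Set.range (f ≫ g).j)ᶜ := fun ⟨y, hy⟩ => hv ⟨y, g.j.injective hy⟩
      exact (congrArg c (Walled.Hom.comp_ζ_of_mem f g t v hv hz').symm).trans (h2 (t, ⟨_, hz'⟩))
    · rintro ⟨t, z, hz⟩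
      exact h2' t z hz
  · rintro ⟨b, ⟨h1, h2⟩, h3, h4⟩
    refine ⟨fun x => (h3 (f.i x)).trans (congrArg g.j (h1 x)), ?_⟩
    rintro ⟨t, z, hz⟩
    rcases Walled.Hom.compl_cases f g hz with ⟨v, hv, rfl⟩ | hz'
    · refine (congrArg c (Walled.Hom.comp_ζ_of_mem f g t v hv hz)).trans ?_
      exact (h3 _).trans (congrArg g.j (h2 (t, ⟨v, hv⟩)))
    · exact (congrArg c (Walled.Hom.comp_ζ_of_notMem f g t z hz' hz)).trans (h4 (t, ⟨z, hz'⟩))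

/-- The functor `k hom_FI(-,-)^tr` on `ℭ`: a morphism `(i, j, α) : (X, Y) ⟶ (U, V)` sends `[a]`, for
`a : X ↪ Y`, to the sum of the `[b]` over all injections `b : U ↪ V` with `b ∘ i = j ∘ a` and such
that `b ∘ α` is the inclusion of `V ∖ j(Y)`. -/
def homFItr (k : Type u) [CommRing k] : CatC.{u} ⥤ ModuleCat.{u} k where
  obj P := ModuleCat.of k ((P.X ↪ P.Y) →₀ k)
  map f := ModuleCat.ofHom (relMap k (extendsInj f))
  map_id P := by
    refine congrArg ModuleCat.ofHom (relMap_id k _ fun a b => ⟨fun h => ?_, fun h => ?_⟩)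
    · exact DFunLike.ext _ _ fun x => (h.1 x).symm
    · exact ⟨fun x => by rw [h]; rfl, fun p => (p.2.2 ⟨p.2.1, rfl⟩).elim⟩
  map_comp f g := by
    refine congrArg ModuleCat.ofHom (relMap_comp k _ _ _ (extendsInj_comp f g) ?_)
    rintro b b' c ⟨h, -⟩ ⟨h', -⟩
    exact DFunLike.ext _ _ fun x => g.j.injective ((h x).symm.trans (h' x))

end HomFI

section Beads

/-- An arrangement of beads labelled by `X` into columns indexed by `Y`, each column containing one
or two (ordered) beads: `pos x = (y, r)` means that the bead `x` lies in column `y`, in the bottom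
row if `r = 0` and in the top row if `r = 1`. Every column has a bottom bead. -/
@[ext]
structure Beads (X Y : Type u) where
  pos : X ↪ Y × Fin 2
  bottom : ∀ y, ∃ x, pos x = (y, 0)

namespace Beads

variable {X Y : Type u}

instance [Finite X] [Finite Y] : Finite (Beads X Y) :=
  Finite.of_injective Beads.pos fun _ _ h => Beads.ext h

/-- Relabelling the beads by a permutation `e`: the bead `e x` takes the place of `x`. -/
def relabel (e : Equiv.Perm X) (φ : Beads X Y) : Beads X Y where
  pos := e.symm.toEmbedding.trans φ.pos
  bottom y := by
    obtain ⟨x, hx⟩ := φ.bottom y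
    exact ⟨e x, by simpa using hx⟩

/-- Relabelling as a permutation of the set of bead arrangements. -/
def relabelEquiv (e : Equiv.Perm X) : Beads X Y ≃ Beads X Y where
  toFun := relabel e
  invFun := relabel e.symm
  left_inv φ := by
    ext x : 2
    simp [relabel]
  right_inv φ := by
    ext x : 2
    simp [relabel]

/-- For a morphism `(i, j, ζ) : (X, Y) ⟶ (U, V)` of `𝔇` and bead arrangements `φ` of `X` in `Y`, `ψ`
of `U` in `V`: `ψ` extends `φ` along `i` and `j` and, for `v ∈ V ∖ j(Y)`, the column of `v` consists
of `ζ(1, v)` (bottom) and `ζ(2, v)` (top). Thus the remaining beads are placed in the top row,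
on columns of `φ` with one element. -/
def Extends {P Q : CatD.{u}} (f : P ⟶ Q) (φ : Beads P.X P.Y) (ψ : Beads Q.X Q.Y) : Prop :=
  (∀ x, ψ.pos (f.i x) = (f.j (φ.pos x).1, (φ.pos x).2)) ∧ ∀ p, ψ.pos (f.ζ p).1 = (p.2.1, p.1)

theorem extends_comp {P Q R : CatD.{u}} (f : P ⟶ Q) (g : Q ⟶ R) (φ : Beads P.X P.Y)
    (χ : Beads R.X R.Y) : Extends (f ≫ g) φ χ ↔ ∃ ψ, Extends f φ ψ ∧ Extends g ψ χ := by
  constructor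
  · rintro ⟨h1, h2⟩
    have h2' : ∀ t z (hz : z ∈ (Set.range g.j)ᶜ), χ.pos (g.ζ (t, ⟨z, hz⟩)).1 = (z, t) := by
      intro t z hz
      have hz' : z ∈ (Set.range (f ≫ g).j)ᶜ := fun ⟨y, hy⟩ => hz ⟨f.j y, hy⟩
      exact (congrArg χ.pos (Walled.Hom.comp_ζ_of_notMem f g t z hz hz').symm).trans
        (h2 (t, ⟨z, hz'⟩))
    have h2'' : ∀ t v (hv : v ∈ (Set.range f.j)ᶜ),
        χ.pos (g.i (f.ζ (t, ⟨v, hv⟩)).1) = (g.j v, t) := by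
      intro t v hv
      have hz' : g.j v ∈ (Set.range (f ≫ g).j)ᶜ := fun ⟨y, hy⟩ => hv ⟨y, g.j.injective hy⟩
      exact (congrArg χ.pos (Walled.Hom.comp_ζ_of_mem f g t v hv hz').symm).trans
        (h2 (t, ⟨_, hz'⟩))
    have hmem : ∀ x, ∃ y, g.j y = (χ.pos (g.i x)).1 := by
      intro x
      by_contra hx
      exact g.ζ_ne _ x (χ.pos.injective (h2' (χ.pos (g.i x)).2 (χ.pos (g.i x)).1 hx)).symm
    choose b hb using hmem
    have hb' : ∀ x v t, χ.pos (g.i x) = (g.j v, t) → (b x, (χ.pos (g.i x)).2) = (v, t) := by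
      intro x v t h
      refine Prod.ext (g.j.injective ((hb x).trans ?_)) ?_
      · exact congrArg Prod.fst h
      · have h' := congrArg Prod.snd h
        exact h'
    refine ⟨⟨⟨fun x => (b x, (χ.pos (g.i x)).2), fun x y h => ?_⟩, fun v => ?_⟩,
      ⟨fun x => hb' _ _ _ (h1 x), ?_⟩, fun x => ?_, ?_⟩
    · have h1 : b x = b y := congrArg Prod.fst h
      have h2 := congrArg Prod.snd h
      exact g.i.injective (χ.pos.injective (Prod.ext (by rw [← hb, ← hb, h1]) h2))
    · by_cases hv : v ∈ Set.range f.j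
      · obtain ⟨y, rfl⟩ := hv
        obtain ⟨x, hx⟩ := φ.bottom y
        refine ⟨f.i x, hb' _ _ _ ((h1 x).trans ?_)⟩
        rw [hx]
        rfl
      · exact ⟨(f.ζ (0, ⟨v, hv⟩)).1, hb' _ _ _ (h2'' 0 v hv)⟩
    · rintro ⟨t, v, hv⟩
      exact hb' _ _ _ (h2'' t v hv)
    · exact Prod.ext (hb x).symm rfl
    · rintro ⟨t, z, hz⟩
      exact h2' t z hz
  · rintro ⟨ψ, ⟨h1, h2⟩, h3, h4⟩
    refine ⟨fun x => (h3 (f.i x)).trans ?_, ?_⟩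
    · rw [h1]
      rfl
    · rintro ⟨t, z, hz⟩
      rcases Walled.Hom.compl_cases f g hz with ⟨v, hv, rfl⟩ | hz'
      · refine (congrArg χ.pos (Walled.Hom.comp_ζ_of_mem f g t v hv hz)).trans ?_
        refine (h3 _).trans ?_
        rw [h2]
      · exact (congrArg χ.pos (Walled.Hom.comp_ζ_of_notMem f g t z hz' hz)).trans
          (h4 (t, ⟨z, hz'⟩))

end Beads

/-- The functor `k Beads^{[1,2]}` on `𝔇`: a morphism sends `[φ]` to the sum of all the bead
arrangements that extend `φ` along it. -/
def kBeads (k : Type u) [CommRing k] : CatD.{u} ⥤ ModuleCat.{u} k where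
  obj P := ModuleCat.of k (Beads P.X P.Y →₀ k)
  map f := ModuleCat.ofHom (relMap k (Beads.Extends f))
  map_id P := by
    refine congrArg ModuleCat.ofHom (relMap_id k _ fun a b => ⟨fun h => ?_, fun h => ?_⟩)
    · exact Beads.ext (DFunLike.ext _ _ fun x => (h.1 x).symm)
    · exact ⟨fun x => by rw [h]; rfl, fun p => (p.2.2 ⟨p.2.1, rfl⟩).elim⟩
  map_comp f g := by
    refine congrArg ModuleCat.ofHom (relMap_comp k _ _ _ (Beads.extends_comp f g) ?_)
    rintro φ φ' ψ ⟨h, -⟩ ⟨h', -⟩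
    refine Beads.ext (DFunLike.ext _ _ fun x => ?_)
    have hx := (h x).symm.trans (h' x)
    exact Prod.ext (g.j.injective (congrArg Prod.fst hx)) (congrArg (fun z => z.2) hx)

variable {k : Type u} [CommRing k]

variable (k) in
open Classical in
/-- The submodule of `k Beads^{[1,2]}(X, Y)` spanned by the `[φ] + [τ φ]`, where `τ` is a
transposition exchanging the two labels of a column of `φ` of cardinal two. -/
def beadsSub (X Y : Type u) : Submodule k (Beads X Y →₀ k) :=
  Submodule.span k {m | ∃ (φ : Beads X Y) (x x' : X), x ≠ x' ∧ (φ.pos x).1 = (φ.pos x').1 ∧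
    Finsupp.single φ 1 + Finsupp.single (φ.relabel (Equiv.swap x x')) 1 = m}

theorem beadsSub_le {P Q : CatD.{u}} (f : P ⟶ Q) :
    beadsSub k P.X P.Y ≤ (beadsSub k Q.X Q.Y).comap ((kBeads k).map f).hom := by
  classical
  refine Submodule.span_le.2 ?_
  rintro _ ⟨φ, x, x', hx, hc, rfl⟩
  have := relMap_add_mem k (Beads.Extends f) (Beads.Extends f) φ (φ.relabel (Equiv.swap x x'))
    (Beads.relabelEquiv (Equiv.swap (f.i x) (f.i x'))) ?_ (beadsSub k Q.X Q.Y) ?_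
  · rw [← map_add] at this
    exact this
  · have hs : ∀ z, Equiv.swap (f.i x) (f.i x') (f.i z) = f.i (Equiv.swap x x' z) :=
      fun z => (f.i.injective.swap_apply x x' z)
    have hn : ∀ p, Equiv.swap (f.i x) (f.i x') (f.ζ p).1 = (f.ζ p).1 := fun p =>
      Equiv.swap_apply_of_ne_of_ne (f.ζ_ne p x).symm (f.ζ_ne p x').symm
    intro ψ
    refine and_congr ⟨fun h z => ?_, fun h z => ?_⟩ (forall_congr' fun p => ?_)
    · have := h (Equiv.swap x x' z)
      simpa [Beads.relabelEquiv, Beads.relabel, hs] using this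
    · have := h (Equiv.swap x x' z)
      simpa [Beads.relabelEquiv, Beads.relabel, hs] using this
    · simp [Beads.relabelEquiv, Beads.relabel, hn]
  · intro ψ hψ
    refine Submodule.subset_span ⟨ψ, f.i x, f.i x', f.i.injective.ne hx, ?_, ?_⟩
    · rw [hψ.1, hψ.1, hc]
    · rfl

/-- The functor `Beads_k^{[1,2],±}` on `𝔇`, the quotient of `k Beads^{[1,2]}` by the relations
`[φ] + [τ φ] = 0`. -/
def beadsPMObj (k : Type u) [CommRing k] : CatD.{u} ⥤ ModuleCat.{u} k :=
  quotFun (kBeads k) (fun P => beadsSub k P.X P.Y) beadsSub_le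

theorem beadsPMObj_anti (P : CatD.{u}) :
    (beadsPMObj k).map P.iota + (beadsPMObj k).map P.tau = 0 := by
  classical
  refine ModuleCat.hom_ext (LinearMap.ext fun m => ?_)
  obtain ⟨m, rfl⟩ := Submodule.mkQ_surjective _ m
  have key : (beadsSub k P.addPair.X P.addPair.Y).mkQ ∘ₗ
      (relMap k (Beads.Extends P.iota) + relMap k (Beads.Extends P.tau)) = 0 := by
    refine Finsupp.lhom_ext' fun φ => LinearMap.ext_ring ?_
    refine (Submodule.Quotient.mk_eq_zero _).2 ?_
    let σ : Equiv.Perm P.addPair.X := Equiv.swap (Sum.inr 0) (Sum.inr 1)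
    have hmem := relMap_add_mem k (Beads.Extends P.iota) (Beads.Extends P.tau) φ φ
      (Beads.relabelEquiv σ) ?_
      (beadsSub k P.addPair.X P.addPair.Y) ?_
    · exact hmem
    · intro ψ
      have hs : ∀ t : Fin 2, σ (Sum.inr (Equiv.swap 0 1 t)) = Sum.inr t := fun t => by
        fin_cases t
        · exact Equiv.swap_apply_right _ _
        · exact Equiv.swap_apply_left _ _
      have hn : ∀ x : P.X, σ (Sum.inl x) = Sum.inl x := fun x =>
        Equiv.swap_apply_of_ne_of_ne Sum.inl_ne_inr Sum.inl_ne_inr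
      refine and_congr (forall_congr' fun x => ?_) (forall_congr' fun p => ?_)
      · exact iff_of_eq (congrArg (fun z => ψ.pos z = _) (hn x))
      · exact iff_of_eq (congrArg (fun z => ψ.pos z = _) (hs p.1))
    · intro ψ hψ
      have hv : (Sum.inr () : P.Y ⊕ Unit) ∈ (Set.range P.iota.j)ᶜ := by
        rintro ⟨y, hy⟩
        cases hy
      have h0 : ψ.pos (Sum.inr 0) = (Sum.inr (), 0) := hψ.2 (0, ⟨_, hv⟩)
      have h1 : ψ.pos (Sum.inr 1) = (Sum.inr (), 1) := hψ.2 (1, ⟨_, hv⟩)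
      refine Submodule.subset_span ⟨ψ, Sum.inr 0, Sum.inr 1, ?_, ?_, rfl⟩
      · exact fun h => absurd (Sum.inr_injective h) (by decide)
      · rw [h0, h1]
  exact LinearMap.congr_fun key m

/-- `Beads_k^{[1,2],±}` as an `𝔈`-module. -/
def beadsPM (k : Type u) [CommRing k] : LinMod k (CatE k) := liftE (beadsPMObj k) beadsPMObj_anti

end Beads

end

noncomputable section

section LeftAdjoints

variable (k : Type u) [CommRing k]

/-- The functor `H^ℭ_{ℭ₀}`, left adjoint to extension by zero. -/
def HC : (CatC.{u} ⥤ ModuleCat.{u} k) ⥤ (CatC0.{u} ⥤ ModuleCat.{u} k) :=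
  (Walled.extZero Unit (ModuleCat.{u} k)).leftAdjoint

/-- The functor `H^𝔈_{𝔈₀}`, left adjoint to extension by zero. -/
def HE : LinMod k (CatE k) ⥤ LinMod k (CatE0 k) := (extE k).leftAdjoint

/-- The antisymmetrization functor `q^±`, left adjoint to restriction along `k𝔇₀ ⥤ 𝔈₀`. -/
def qpm0 : (CatD0.{u} ⥤ ModuleCat.{u} k) ⥤ LinMod k (CatE0 k) := (resE0 k).leftAdjoint

end LeftAdjoints

end

/-! By Yoneda, it is enough that both sides corepresent the same functor on `𝔈₀`-modules, namely
`homBeadsExtZero`: it sends `G` to the natural transformations from `kBeads k` to the extension by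
zero of `G`, taken over `𝔇`.

On the left, the adjunction turns maps out of `H^𝔈_{𝔈₀}` of the signed beads into maps from the
signed beads to an extension by zero. The relations `[φ] + [τφ]` are forced in any target where `ι +
τ` acts by zero (`Beads.beadsSub_le_ker`). Indeed, deleting a two-bead column leaves an arrangement
whose images under `ι` and `τ`, followed by an isomorphism, are `[φ]` and `[τφ]`. Hence such maps
are the same as maps out of the unsigned `kBeads k`.

On the right, `q^±` is removed by its adjunction, and two facts remain. First, induction commutes
with the passage to indecomposables (`indecIndIso`): modulo the images of non-bijective morphisms,
`Ind F` is `Ind₀` of the corresponding quotient of `F`. The core is `decSub_indObj`, which rests on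
a comparison of bijectivity in both directions: a morphism of `𝔇` that contracts to a bijective
morphism of `ℭ` is bijective, and every morphism of `ℭ` into some `(U ∖ κ(V), V)` is contracted from
a morphism of `𝔇` that is bijective only if the given one is. Second, `Ind` of `homFItr k` is
`kBeads k` (`Beads.indHomFIIso`): an arrangement is its bottom row, an injection `κ` of columns into
beads, together with its top row, an injection of the remaining beads into columns. The universal
property of indecomposables over `𝔇` then gives the same functor. -/

noncomputable section

/-! ### Quotients of functors by kernels -/

section QuotientIso

variable {k : Type u} [CommRing k] {A : Type*} [Category* A]

/-- A natural transformation of functors to `k`-modules with bijective components is invertible. -/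
def natIsoOfBijective {F G : A ⥤ ModuleCat.{u} k} (η : F ⟶ G)
    (h : ∀ a, Function.Bijective (η.app a).hom) : F ≅ G :=
  haveI : ∀ a, IsIso (η.app a) := fun a => (ConcreteCategory.isIso_iff_bijective _).2 (h a)
  haveI : IsIso η := NatIso.isIso_of_isIso_app η
  asIso η

/-- The first isomorphism theorem for functors to `k`-modules. -/
def quotFunIso {F G : A ⥤ ModuleCat.{u} k} (N : ∀ a, Submodule k (F.obj a))
    (hN : ∀ {a b} (f : a ⟶ b), N a ≤ (N b).comap (F.map f).hom) (η : F ⟶ G)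
    (hs : ∀ a, Function.Surjective (η.app a).hom) (hk : ∀ a, N a = LinearMap.ker (η.app a).hom) :
    quotFun F N hN ≅ G :=
  natIsoOfBijective ((quotHomEquiv F N hN G).symm ⟨η, fun a => (hk a).le⟩) fun a => by
    change Function.Bijective ((N a).liftQ (η.app a).hom (hk a).le)
    refine ⟨LinearMap.ker_eq_bot.1 (Submodule.ker_liftQ_eq_bot _ _ _ (hk a).ge), fun y => ?_⟩
    obtain ⟨x, rfl⟩ := hs a y
    exact ⟨(N a).mkQ x, rfl⟩

end QuotientIso

/-! ### Universality of the sign relation on bead arrangements -/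

namespace Beads

variable {k : Type u} [CommRing k]

/-- When `ζ` is bijective, every bead of the target comes from `i` or from `ζ`, and its position is
prescribed in both cases. -/
theorem Extends.unique {P Q : CatD.{u}} {f : P ⟶ Q} (hf : Walled.bij (Fin 2) f)
    {φ : Beads P.X P.Y} {ψ ψ' : Beads Q.X Q.Y} (h : Extends f φ ψ) (h' : Extends f φ ψ') :
    ψ = ψ' := by
  refine Beads.ext (DFunLike.ext _ _ fun x => ?_)
  rcases (Walled.bij_iff f).1 hf x with ⟨x, rfl⟩ | ⟨p, rfl⟩
  · exact (h.1 x).trans (h'.1 x).symm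
  · exact (h.2 p).trans (h'.2 p).symm

/-- The sum over all extensions has a single term, by `Extends.unique`. So morphisms of `𝔇₀` send a
basis vector to a basis vector as soon as an extension exists. -/
theorem kBeads_map_single {P Q : CatD.{u}} {f : P ⟶ Q} (hf : Walled.bij (Fin 2) f)
    {φ : Beads P.X P.Y} {ψ : Beads Q.X Q.Y} (h : Extends f φ ψ) :
    ((kBeads k).map f).hom (Finsupp.single φ 1) = (Finsupp.single ψ 1 : Beads Q.X Q.Y →₀ k) := by
  classical
  refine (relMap_single k _ φ).trans ?_
  refine Eq.trans (congrArg (fun s => Finset.sum s _) ?_) (Finset.sum_singleton _ ψ)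
  ext ψ'
  simpa using ⟨fun h' => h'.unique hf h, fun e => e ▸ h⟩

section RemoveColumn

variable {P : CatD.{u}} (φ : Beads P.X P.Y) {x x' : P.X} {y : P.Y}

variable (x x' y) in
/-- The object obtained from `P` by removing two elements of the first set and one of the
second. -/
def removePair : CatD.{u} := ⟨{z : P.X // z ≠ x ∧ z ≠ x'}, {v : P.Y // v ≠ y}⟩

variable (x x' y) in
open Classical in
/-- The isomorphism from `removePair` with a pair added back to `P`. -/
def addPairTo (h : x ≠ x') : (removePair x x' y).addPair ⟶ P where
  i := ⟨Sum.elim Subtype.val fun t => if t = 0 then x else x', by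
    rintro (⟨z, hz⟩ | t) (⟨w, hw⟩ | s) e
    · exact congrArg Sum.inl (Subtype.ext e)
    · change z = if s = 0 then x else x' at e
      split_ifs at e
      · exact (hz.1 e).elim
      · exact (hz.2 e).elim
    · change (if t = 0 then x else x') = w at e
      split_ifs at e
      · exact (hw.1 e.symm).elim
      · exact (hw.2 e.symm).elim
    · change (if t = 0 then x else x') = if s = 0 then x else x' at e
      split_ifs at e with h1 h2 h2
      · rw [h1, h2]
      · exact (h e).elim
      · exact (h e.symm).elim
      · congr 1
        omega⟩
  j := ⟨Sum.elim Subtype.val fun _ => y, by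
    rintro (⟨z, hz⟩ | t) (⟨w, hw⟩ | s) e
    · exact congrArg Sum.inl (Subtype.ext e)
    · exact (hz e).elim
    · exact (hw e.symm).elim
    · rfl⟩
  ζ :=
    -- The map on columns is surjective, so `ζ` has empty domain.
    have hs (v : P.Y) : v ∈ Set.range
        (Sum.elim (Subtype.val : {v : P.Y // v ≠ y} → P.Y) fun _ : Unit => y) := by
      by_cases hv : v = y
      · exact ⟨Sum.inr (), hv.symm⟩
      · exact ⟨Sum.inl ⟨v, hv⟩, rfl⟩
    ⟨fun p => (p.2.2 (hs _)).elim, fun p => (p.2.2 (hs _)).elim⟩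

theorem bij_addPairTo (h : x ≠ x') : Walled.bij (Fin 2) (addPairTo x x' y h) := by
  refine (Walled.bij_iff _).2 fun z => Or.inl ?_
  by_cases h1 : z = x
  · exact ⟨Sum.inr 0, h1.symm⟩
  by_cases h2 : z = x'
  · exact ⟨Sum.inr 1, h2.symm⟩
  · exact ⟨Sum.inl ⟨z, h1, h2⟩, rfl⟩

variable (h0 : φ.pos x = (y, 0)) (h1 : φ.pos x' = (y, 1))

/-- The bead arrangement obtained by removing a column with two beads. -/
def removeColumn : Beads (removePair x x' y).X (removePair x x' y).Y where
  -- Both places of column `y` are taken by `x` and `x'`, so any other bead lies in another column.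
  pos := ⟨fun z => (⟨(φ.pos z.1).1, fun h => by
      rcases Fin.exists_fin_two.1 ⟨(φ.pos z.1).2, rfl⟩ with h2 | h2
      · exact z.2.1 (φ.pos.injective ((Prod.ext h h2).trans h0.symm))
      · exact z.2.2 (φ.pos.injective ((Prod.ext h h2).trans h1.symm))⟩, (φ.pos z.1).2),
    fun z w h => Subtype.ext (φ.pos.injective (Prod.ext
      (congrArg (fun q => q.1.1) h) (congrArg (fun q => q.2) h)))⟩
  bottom v := by
    obtain ⟨z, hz⟩ := φ.bottom v.1
    refine ⟨⟨z, ?_, ?_⟩, Prod.ext (Subtype.ext (congrArg Prod.fst hz)) (congrArg (fun q => q.2) hz :)⟩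
    · rintro rfl
      exact v.2 (congrArg Prod.fst (hz.symm.trans h0))
    · rintro rfl
      exact v.2 (congrArg Prod.fst (hz.symm.trans h1))

/-- Reinserting the deleted column by `ι` recovers `φ`, and by `τ` the arrangement with `x` and `x'`
exchanged. The permutation `e` treats both cases at once: it decides which of the two beads goes to
row `t`. -/
theorem extends_removeColumn (h : x ≠ x') (e : Equiv.Perm (Fin 2)) (ψ : Beads P.X P.Y)
    (hψ : ∀ z, z ≠ x → z ≠ x' → ψ.pos z = φ.pos z)
    (hψe : ∀ t, ψ.pos (if e t = 0 then x else x') = (y, t)) :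
    Extends (CatD.insertPair e _ ≫ addPairTo x x' y h) (removeColumn φ h0 h1) ψ := by
  refine ⟨fun z => hψ z.1 z.2.1 z.2.2, ?_⟩
  rintro ⟨t, v, hv⟩
  -- The only column that does not come from `removePair` is the deleted one.
  obtain rfl : v = y := by
    by_contra hvy
    exact hv ⟨⟨v, hvy⟩, rfl⟩
  have hr : (Sum.inr () : {w : P.Y // w ≠ v} ⊕ Unit) ∈
      (Set.range (CatD.insertPair e (removePair x x' v)).j)ᶜ := by
    rintro ⟨w, hw⟩
    cases hw
  refine (congrArg ψ.pos (Walled.Hom.comp_ζ_of_mem (CatD.insertPair e (removePair x x' v))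
    (addPairTo x x' v h) t (Sum.inr ()) hr hv)).trans ?_
  exact hψe t

end RemoveColumn

/-- The sum `[φ] + [τφ]` is the image of the arrangement without the column of `x` and `x'` under `ι
+ τ` followed by `addPairTo`. By naturality, `η` sends it to an image of `ι + τ` acting on `H`,
which is zero. -/
theorem single_add_relabel_mem {P : CatD.{u}} {H : CatD.{u} ⥤ ModuleCat.{u} k}
    (hH : ∀ P : CatD.{u}, H.map P.iota + H.map P.tau = 0) (η : kBeads k ⟶ H)
    (φ : Beads P.X P.Y) {x x' : P.X} {y : P.Y} (h0 : φ.pos x = (y, 0)) (h1 : φ.pos x' = (y, 1))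
    [DecidableEq P.X] :
    (Finsupp.single φ 1 + Finsupp.single (φ.relabel (Equiv.swap x x')) 1 : Beads P.X P.Y →₀ k) ∈
      LinearMap.ker (η.app P).hom := by
  classical
  have h : x ≠ x' := by
    rintro rfl
    exact absurd (congrArg Prod.snd (h0.symm.trans h1)) (by simp)
  have hb (e) : Walled.bij (Fin 2) (CatD.insertPair e _ ≫ addPairTo x x' y h) :=
    (Walled.bij_comp_iff _ _).2 ⟨CatD.bij_insertPair e _, bij_addPairTo h⟩
  have e1 := kBeads_map_single (k := k) (hb 1) (extends_removeColumn φ h0 h1 h 1 φ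
    (fun _ _ _ => rfl) fun t => by fin_cases t <;> simp [h0, h1])
  have e2 := kBeads_map_single (k := k) (hb (Equiv.swap 0 1))
    (extends_removeColumn φ h0 h1 h (Equiv.swap 0 1) (φ.relabel (Equiv.swap x x'))
      (fun z hz hz' => by simp [relabel, Equiv.swap_apply_of_ne_of_ne hz hz'])
      fun t => by fin_cases t <;> simp [relabel, h0, h1])
  have hn (e) := congrArg (fun m => m.hom (Finsupp.single (removeColumn φ h0 h1) (1 : k)))
    (η.naturality (CatD.insertPair e _ ≫ addPairTo x x' y h))
  have s1 := (congrArg (η.app P).hom e1).symm.trans (hn 1)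
  have s2 := (congrArg (η.app P).hom e2).symm.trans (hn (Equiv.swap 0 1))
  have hz : H.map (CatD.insertPair 1 _ ≫ addPairTo x x' y h) +
      H.map (CatD.insertPair (Equiv.swap 0 1) _ ≫ addPairTo x x' y h) = 0 := by
    rw [H.map_comp, H.map_comp, ← Preadditive.add_comp]
    exact (congrArg (· ≫ _) (hH _)).trans Limits.zero_comp
  refine (map_add _ _ _).trans ((congrArg₂ (· + ·) s1 s2).trans ?_)
  exact congrArg (fun m : H.obj _ ⟶ H.obj P => m.hom ((η.app (removePair x x' y)).hom
    (Finsupp.single (removeColumn φ h0 h1) 1 :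
      Beads (removePair x x' y).X (removePair x x' y).Y →₀ k))) hz

/-- The quotient `Beads_k^{[1,2],±}` of `k Beads^{[1,2]}` is universal with respect to the relation
`ι = - τ`. -/
theorem beadsSub_le_ker {H : CatD.{u} ⥤ ModuleCat.{u} k}
    (hH : ∀ P : CatD.{u}, H.map P.iota + H.map P.tau = 0) (η : kBeads k ⟶ H) (P : CatD.{u}) :
    beadsSub k P.X P.Y ≤ LinearMap.ker (η.app P).hom := by
  classical
  refine Submodule.span_le.2 ?_
  rintro _ ⟨φ, x, x', hx, hc, rfl⟩
  refine SetLike.mem_coe.2 ?_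
  -- Two distinct beads of one column lie in different rows. If `x` is the top one, the roles of `x`
  -- and `x'` are exchanged, which leaves the transposition unchanged.
  have hr : (φ.pos x).2 ≠ (φ.pos x').2 := fun hr => hx (φ.pos.injective (Prod.ext hc hr))
  rcases Fin.exists_fin_two.1 ⟨(φ.pos x).2, rfl⟩ with h | h
  · have h' : (φ.pos x').2 = 1 := by omega
    exact single_add_relabel_mem hH η φ (Prod.ext rfl h) (Prod.ext hc.symm h')
  · have h' : (φ.pos x').2 = 0 := by omega
    rw [Equiv.swap_comm]
    exact single_add_relabel_mem hH η φ (Prod.ext rfl h') (Prod.ext hc h)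

end Beads

end

noncomputable section

/-! ### Induction commutes with indecomposables -/

section InductionIndecomposables

variable {k : Type u} [CommRing k]

/-- The image of `push f κ` is always covered by `i` and the values of `ζ` at index `0`, by
construction. The hypothesis says that the complement is covered by `i` and the values at index `1`.
-/
theorem CatD.bij_of_bij_ctrctMap {P Q : CatD.{u}} (f : P ⟶ Q) (κ : P.Y ↪ P.X)
    (h : Walled.bij Unit (CatD.ctrctMap f κ)) : Walled.bij (Fin 2) f := by
  rw [Walled.bij_iff] at h ⊢
  intro x
  by_cases hx : x ∈ Set.range (CatD.push f κ)
  · obtain ⟨v, rfl⟩ := hx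
    by_cases hv : v ∈ Set.range f.j
    · obtain ⟨y, rfl⟩ := hv
      exact Or.inl ⟨κ y, (CatD.push_j f κ y).symm⟩
    · exact Or.inr ⟨(0, ⟨v, hv⟩), (CatD.push_compl f κ v hv).symm⟩
  · rcases h ⟨x, hx⟩ with ⟨z, hz⟩ | ⟨⟨⟨⟩, v⟩, hp⟩
    · exact Or.inl ⟨z.1, congrArg Subtype.val hz⟩
    · exact Or.inr ⟨(1, v), congrArg Subtype.val hp⟩

/-- Induction of an extension by zero kills the morphisms outside `𝔇₀`. -/
theorem indMap_extZero (G : CatC0.{u} ⥤ ModuleCat.{u} k) {P Q : CatD.{u}} (f : P ⟶ Q)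
    (hf : ¬ Walled.bij (Fin 2) f) :
    indMap ((Walled.extZero Unit (ModuleCat.{u} k)).obj G) f = 0 := by
  classical
  refine DirectSum.linearMap_ext _ fun κ => LinearMap.ext fun x => ?_
  refine (indMap_lof _ f κ x).trans ?_
  have h0 : ((Walled.extZero Unit (ModuleCat.{u} k)).obj G).map (CatD.ctrctMap f κ) = 0 :=
    Walled.extZeroObj_map_neg G _ (mt (CatD.bij_of_bij_ctrctMap f κ) hf)
  rw [h0]
  exact map_zero _

section Expand

variable {P : CatD.{u}} {κ : P.Y ↪ P.X} {A : CatC.{u}} (g : A ⟶ P.ctrct κ)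

/-- The object `(X ⨿ Y, Y)` of `𝔇` associated to `(X, Y)`. -/
def CatC.expand (A : CatC.{u}) : CatD.{u} := ⟨A.X ⊕ A.Y, A.Y⟩

/-- The morphism of `𝔇` which induces a given morphism `(X, Y) ⟶ (U ∖ κ(V), V)` of `ℭ`. -/
def CatC.expandMap : A.expand ⟶ P where
  -- The summand `X` lands outside the image of `κ` and the summand `Y` inside it, so the two cannot
  -- collide.
  i := ⟨Sum.elim (fun x => (g.i x).1) fun y => κ (g.j y), by
    rintro (x | y) (x' | y') h
    · exact congrArg Sum.inl (g.i.injective (Subtype.ext h))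
    · exact ((g.i x).2 ⟨_, h.symm⟩).elim
    · exact ((g.i x').2 ⟨_, h⟩).elim
    · exact congrArg Sum.inr (g.j.injective (κ.injective h))⟩
  j := g.j
  -- Index `0` carries the values of `κ` on the new columns, so that pushing forward the inclusion
  -- of `Y` gives `κ`; index `1` carries the third component of `g`.
  ζ := ⟨fun p => ⟨if p.1 = 0 then κ p.2.1 else (g.ζ ((), p.2)).1.1, by
      rintro ⟨x | y, h⟩
      · change (g.i x).1 = _ at h
        split_ifs at h
        · exact (g.i x).2 ⟨_, h.symm⟩
        · exact g.ζ_ne _ _ (Subtype.ext h)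
      · change κ (g.j y) = _ at h
        split_ifs at h
        · exact p.2.2 ⟨y, κ.injective h⟩
        · exact (g.ζ ((), p.2)).1.2 ⟨_, h⟩⟩, by
    rintro ⟨t, v⟩ ⟨t', v'⟩ h
    have h := congrArg Subtype.val h
    dsimp only at h
    split_ifs at h with h1 h2 h2
    · exact Prod.ext (h1.trans h2.symm) (Subtype.ext (κ.injective h))
    · exact ((g.ζ ((), v')).1.2 ⟨_, h⟩).elim
    · exact ((g.ζ ((), v)).1.2 ⟨_, h.symm⟩).elim
    · have := g.ζ.injective (Subtype.ext (Subtype.ext h))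
      have hv : v = v' := congrArg Prod.snd this
      have ht : t = t' := by
        omega
      rw [hv, ht]⟩

variable (A) in
/-- The isomorphism `(X, Y) ⟶ ((X ⨿ Y) ∖ Y, Y)`. -/
def CatC.toCtrctExpand : A ⟶ A.expand.ctrct Function.Embedding.inr where
  i := ⟨fun x => ⟨Sum.inl x, by rintro ⟨y, hy⟩; cases hy⟩,
    fun _ _ h => Sum.inl_injective (congrArg Subtype.val h)⟩
  j := .refl _
  ζ := ⟨fun p => (p.2.2 ⟨p.2.1, rfl⟩).elim, fun p => (p.2.2 ⟨p.2.1, rfl⟩).elim⟩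

/-- Pushing the inclusion of `Y` along `expandMap g` gives `κ` only up to a propositional equality,
on which the type of the contracted morphism depends; hence an equality of dependent pairs. -/
theorem CatC.ctrctMap_expandMap :
    (⟨_, CatC.toCtrctExpand A ≫ CatD.ctrctMap (CatC.expandMap g) Function.Embedding.inr⟩ :
      Σ κ, A ⟶ P.ctrct κ) = ⟨κ, g⟩ := by
  refine CatD.sigma_ctrct_ext (DFunLike.ext _ _ fun v => ?_) _ _ (fun _ => rfl) (fun _ => rfl) ?_
  · by_cases hv : v ∈ Set.range g.j
    · obtain ⟨y, rfl⟩ := hv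
      exact CatD.push_j (CatC.expandMap g) _ y
    · exact CatD.push_compl (CatC.expandMap g) _ v hv
  · rintro ⟨⟩ v hv hv'
    exact congrArg Subtype.val (Walled.Hom.comp_ζ_of_notMem (CatC.toCtrctExpand A)
      (CatD.ctrctMap (CatC.expandMap g) Function.Embedding.inr) () v hv' hv)

/-- An element outside the image of `κ` can only be reached from the summand `X` or from `ζ` at
index `1`, and both of these belong to `g`. -/
theorem CatC.bij_of_bij_expandMap (h : Walled.bij (Fin 2) (CatC.expandMap g)) :
    Walled.bij Unit g := by
  rw [Walled.bij_iff] at h ⊢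
  intro x
  rcases h x.1 with ⟨z | y, hz⟩ | ⟨⟨t, v⟩, hp⟩
  · exact Or.inl ⟨z, Subtype.ext hz⟩
  · exact (x.2 ⟨_, hz⟩).elim
  · change (if t = 0 then κ v.1 else (g.ζ ((), v)).1.1) = x.1 at hp
    split_ifs at hp
    · exact (x.2 ⟨_, hp⟩).elim
    · exact Or.inr ⟨((), v), Subtype.ext hp⟩

end Expand

variable (F : CatC.{u} ⥤ ModuleCat.{u} k)

-- A generator `F(g)(z)` with `g` non-bijective, placed in the summand `κ`, is the image under `Ind
-- F (expandMap g)` of an element of the summand of the inclusion of `Y`, and `expandMap g` is again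
-- non-bijective.
open Classical in
theorem lof_mem_decSub (P : CatD.{u}) (κ : P.Y ↪ P.X) {x : F.obj (P.ctrct κ)}
    (hx : x ∈ Walled.decSub F ⟨P.ctrct κ⟩) :
    (DirectSum.lof k (P.Y ↪ P.X) (fun κ => F.obj (P.ctrct κ)) κ x :
      (indObj F).obj P) ∈ Walled.decSub (indObj F) ⟨P⟩ := by
  have : Walled.decSub F ⟨P.ctrct κ⟩ ≤ (Walled.decSub (indObj F) ⟨P⟩).comap
      (DirectSum.lof k (P.Y ↪ P.X) (fun κ => F.obj (P.ctrct κ)) κ) := by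
    refine Submodule.span_le.2 ?_
    rintro _ ⟨(A : CatC), g, z, hg, rfl⟩
    refine Submodule.subset_span ⟨A.expand, CatC.expandMap g,
      DirectSum.lof k (A.expand.Y ↪ A.expand.X) (fun κ => F.obj (A.expand.ctrct κ))
        Function.Embedding.inr ((F.map (CatC.toCtrctExpand A)).hom z),
      mt (CatC.bij_of_bij_expandMap g) hg, ?_⟩
    refine (indMap_lof F _ _ _).trans
      (Eq.trans ?_ (lof_eq_of_sigma_eq F (CatC.ctrctMap_expandMap g) z))
    dsimp only
    rw [F.map_comp]
    rfl
  exact this hx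

/-- This allows the kernel of an induced transformation to be tested one summand at a time. -/
theorem indNat_apply {F G : CatC.{u} ⥤ ModuleCat.{u} k} (η : F ⟶ G) (P : CatD.{u})
    (x : DirectSum (P.Y ↪ P.X) fun κ => F.obj (P.ctrct κ)) (κ : P.Y ↪ P.X) :
    indNat η P x κ = (η.app (P.ctrct κ)).hom (x κ) := by
  classical
  have : DirectSum.component k _ _ κ ∘ₗ indNat η P =
      (η.app (P.ctrct κ)).hom ∘ₗ DirectSum.component k _ _ κ := by
    refine DirectSum.linearMap_ext _ fun κ' => LinearMap.ext fun y => ?_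
    change DirectSum.component k _ _ κ (indNat η P (DirectSum.lof k _ _ κ' y)) =
      (η.app (P.ctrct κ)).hom (DirectSum.component k _ (fun κ => F.obj (P.ctrct κ)) κ
        (DirectSum.lof k _ (fun κ => F.obj (P.ctrct κ)) κ' y))
    rw [indNat_lof]
    by_cases h : κ' = κ
    · subst h
      rw [DirectSum.component.lof_self, DirectSum.component.lof_self]
    · rw [DirectSum.component.of, dif_neg h, DirectSum.component.of, dif_neg h, map_zero]
  exact LinearMap.congr_fun this x

/-- The projection from a functor on `ℭ` to the extension by zero of its indecomposables. -/
def indecUnit : F ⟶ (Walled.extZero Unit (ModuleCat.{u} k)).obj (Walled.indec F) :=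
  Walled.indecEquiv F _ (𝟙 _)

theorem indNat_indecUnit_surjective (P : CatD.{u}) :
    Function.Surjective (indNat (indecUnit F) P) := by
  classical
  intro y
  induction y using DirectSum.induction_on with
  | zero => exact ⟨0, map_zero _⟩
  | of κ y =>
    obtain ⟨x, rfl⟩ := Submodule.mkQ_surjective _ y
    exact ⟨_, indNat_lof _ P κ x⟩
  | add y z hy hz =>
    obtain ⟨x, rfl⟩ := hy
    obtain ⟨w, rfl⟩ := hz
    exact ⟨x + w, map_add _ _ _⟩

/-- Decomposable elements die because induction of an extension by zero is itself zero outside `𝔇₀`.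
Conversely, an element of the kernel has all its components decomposable for `F`, and
`lof_mem_decSub` makes each of them decomposable in the direct sum. -/
theorem decSub_indObj (P : CatD.{u}) :
    Walled.decSub (indObj F) ⟨P⟩ = LinearMap.ker (indNat (indecUnit F) P) := by
  classical
  refine le_antisymm (Submodule.span_le.2 ?_) ?_
  · rintro _ ⟨Q, f, x, hf, rfl⟩
    refine (congrArg (fun m => m.hom x) (((ind k).map (indecUnit F)).naturality f)).trans ?_
    exact LinearMap.congr_fun (indMap_extZero _ f hf) _
  · intro (x : DirectSum (P.Y ↪ P.X) fun κ => F.obj (P.ctrct κ)) hx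
    have hx' (κ) : x κ ∈ Walled.decSub F ⟨P.ctrct κ⟩ := by
      refine (Submodule.Quotient.mk_eq_zero _).1 ?_
      refine (indNat_apply (indecUnit F) P x κ).symm.trans ?_
      have hx0 : indNat (indecUnit F) P x = 0 := hx
      exact congrArg (fun z => z κ) hx0
    have hs : ∑ κ ∈ DFinsupp.support x, DirectSum.lof k (P.Y ↪ P.X)
        (fun κ => F.obj (P.ctrct κ)) κ (x κ) = x := DirectSum.sum_support_of x
    rw [← hs]
    exact Submodule.sum_mem _ fun κ _ => lof_mem_decSub F P κ (hx' κ)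

/-- Induction commutes with the passage to indecomposables. -/
def indecIndIso : Walled.indec ((ind k).obj F) ≅ (ind0 k).obj (Walled.indec F) :=
  quotFunIso _ (Walled.decSub_le _)
    -- The comparison map is `Ind` of the unit of `F`, restricted to `𝔇₀`.
    (Functor.whiskerLeft (wideSubcategoryInclusion _) ((ind k).map (indecUnit F)))
    (fun P => indNat_indecUnit_surjective F P.obj) fun P => decSub_indObj F P.obj

end InductionIndecomposables

end

/-! ### Bead arrangements as pairs of rows -/

noncomputable section

/-- The injection `j` restricts to a bijection between the index sets of the two sums. -/
theorem relSum_eq_lmapDomain (k : Type u) [CommRing k] {A B A' B' : Type u} [Finite B] [Finite B']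
    (R : A → B → Prop) (R' : A' → B' → Prop) {a : A} {a' : A'} {j : B → B'}
    (hj : Function.Injective j) (h : ∀ b, R a b → R' a' (j b))
    (h' : ∀ b', R' a' b' → ∃ b, R a b ∧ j b = b') :
    relSum k R' a' = Finsupp.lmapDomain k k j (relSum k R a) := by
  classical
  rw [relSum, relSum, map_sum]
  refine (Finset.sum_bij (fun b _ => j b) (fun b hb => ?_) (fun b _ b' _ e => hj e)
    (fun b' hb' => ?_) fun b _ => ?_).symm
  · simpa using h b (by simpa using hb)
  · obtain ⟨b, hb, e⟩ := h' b' (by simpa using hb')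
    exact ⟨b, by simpa using hb, e⟩
  · exact Finsupp.mapDomain_single

namespace Beads

variable {X Y : Type u}

/-- The injection which sends a column to its bottom bead. -/
def bottomBead (φ : Beads X Y) : Y ↪ X :=
  ⟨fun y => (φ.bottom y).choose, fun y y' h => by
    have e := (φ.bottom y).choose_spec
    dsimp only at h
    rw [h] at e
    exact congrArg Prod.fst (e.symm.trans (φ.bottom y').choose_spec)⟩

theorem pos_bottomBead (φ : Beads X Y) (y : Y) : φ.pos (φ.bottomBead y) = (y, 0) :=
  (φ.bottom y).choose_spec

/-- The bottom place of the column of `x` is already occupied by its bottom bead, and `pos` is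
injective. -/
theorem pos_snd_of_notMem (φ : Beads X Y) {x : X} (hx : x ∉ Set.range φ.bottomBead) :
    (φ.pos x).2 = 1 := by
  rcases Fin.exists_fin_two.1 ⟨(φ.pos x).2, rfl⟩ with h | h
  · exact (hx ⟨(φ.pos x).1, φ.pos.injective ((φ.pos_bottomBead _).trans (Prod.ext rfl h.symm))⟩).elim
  · exact h

/-- The injection which sends a bead of the top row to its column. -/
def topColumn (φ : Beads X Y) : ↥(Set.range φ.bottomBead)ᶜ ↪ Y :=
  ⟨fun x => (φ.pos x.1).1, fun x x' h => Subtype.ext (φ.pos.injective (Prod.ext h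
    ((φ.pos_snd_of_notMem x.2).trans (φ.pos_snd_of_notMem x'.2).symm)))⟩

open Classical in
/-- The bead arrangement with bottom row `κ` and top row `a`. -/
def ofRows (κ : Y ↪ X) (a : ↥(Set.range κ)ᶜ ↪ Y) : Beads X Y where
  pos := ⟨fun x => if h : x ∈ Set.range κ then (h.choose, 0) else (a ⟨x, h⟩, 1), fun x x' h => by
    dsimp only at h
    split_ifs at h with h1 h2 h2
    · exact h1.choose_spec.symm.trans ((congrArg κ (congrArg Prod.fst h)).trans h2.choose_spec)
    · exact absurd (congrArg Prod.snd h) (by simp)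
    · exact absurd (congrArg Prod.snd h) (by simp)
    · exact congrArg Subtype.val (a.injective (congrArg Prod.fst h))⟩
  bottom y := by
    have hm : κ y ∈ Set.range κ := ⟨y, rfl⟩
    refine ⟨κ y, (dif_pos hm).trans (Prod.ext (κ.injective hm.choose_spec) rfl)⟩

theorem ofRows_pos_bottom (κ : Y ↪ X) (a : ↥(Set.range κ)ᶜ ↪ Y) (y : Y) :
    (ofRows κ a).pos (κ y) = (y, 0) := by
  have hm : κ y ∈ Set.range κ := ⟨y, rfl⟩
  exact (dif_pos hm).trans (Prod.ext (κ.injective hm.choose_spec) rfl)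

theorem ofRows_pos_top (κ : Y ↪ X) (a : ↥(Set.range κ)ᶜ ↪ Y) (x : ↥(Set.range κ)ᶜ) :
    (ofRows κ a).pos x.1 = (a x, 1) := dif_neg x.2

theorem eq_ofRows {φ : Beads X Y} {κ : Y ↪ X} {a : ↥(Set.range κ)ᶜ ↪ Y}
    (hκ : ∀ y, φ.pos (κ y) = (y, 0)) (ha : ∀ x, φ.pos x.1 = (a x, 1)) : φ = ofRows κ a := by
  refine Beads.ext (DFunLike.ext _ _ fun x => ?_)
  by_cases hx : x ∈ Set.range κ
  · obtain ⟨y, rfl⟩ := hx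
    exact (hκ y).trans (ofRows_pos_bottom κ a y).symm
  · exact (ha ⟨x, hx⟩).trans (ofRows_pos_top κ a ⟨x, hx⟩).symm

/-- A bead arrangement is given by its bottom row and its top row. -/
def rowsEquiv (X Y : Type u) : (Σ κ : Y ↪ X, ↥(Set.range κ)ᶜ ↪ Y) ≃ Beads X Y where
  toFun p := ofRows p.1 p.2
  invFun φ := ⟨φ.bottomBead, φ.topColumn⟩
  left_inv := by
    rintro ⟨κ, a⟩
    have h : (ofRows κ a).bottomBead = κ := DFunLike.ext _ _ fun y =>
      (ofRows κ a).pos.injective ((pos_bottomBead _ y).trans (ofRows_pos_bottom κ a y).symm)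
    -- The type of the top row depends on the bottom row, so the bottom row is generalized to a
    -- variable before substitution.
    have key : ∀ (κ' : Y ↪ X) (b : ↥(Set.range κ')ᶜ ↪ Y), κ' = κ →
        (∀ x hx hx', b ⟨x, hx⟩ = a ⟨x, hx'⟩) →
        (⟨κ', b⟩ : Σ κ : Y ↪ X, ↥(Set.range κ)ᶜ ↪ Y) = ⟨κ, a⟩ := by
      rintro κ' b rfl hb
      congr 1
      exact DFunLike.ext _ _ fun x => hb x.1 x.2 x.2
    exact key _ _ h fun x _ hx' => congrArg Prod.fst (ofRows_pos_top κ a ⟨x, hx'⟩)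
  right_inv φ := (eq_ofRows φ.pos_bottomBead fun x =>
    Prod.ext rfl (φ.pos_snd_of_notMem x.2)).symm

theorem ofRows_injective (κ : Y ↪ X) : Function.Injective (ofRows κ) := fun a b h =>
  eq_of_heq (Sigma.mk.inj ((rowsEquiv X Y).injective (a₁ := ⟨κ, a⟩) (a₂ := ⟨κ, b⟩) h)).2

/-! ### Extending an arrangement row by row -/

section Extension

variable {P Q : CatD.{u}} (f : P ⟶ Q) (κ : P.Y ↪ P.X) (a : ↥(Set.range κ)ᶜ ↪ P.Y)

/-- With `push f κ` as bottom row, the beads coming from `κ` and from `ζ` at index `0` are placed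
correctly. The conditions on the remaining beads are those for `b` to extend `a` along the
contracted morphism. -/
theorem extends_ofRows {b : ↥(Set.range (CatD.push f κ))ᶜ ↪ Q.Y}
    (h : extendsInj (CatD.ctrctMap f κ) a b) :
    Extends f (ofRows κ a) (ofRows (CatD.push f κ) b) := by
  refine ⟨fun x => ?_, ?_⟩
  · by_cases hx : x ∈ Set.range κ
    · obtain ⟨y, rfl⟩ := hx
      rw [ofRows_pos_bottom, ← CatD.push_j, ofRows_pos_bottom]
    · have h1 := ofRows_pos_top (CatD.push f κ) b ((CatD.ctrctMap f κ).i ⟨x, hx⟩)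
      rw [ofRows_pos_top κ a ⟨x, hx⟩]
      exact h1.trans (Prod.ext (h.1 ⟨x, hx⟩) rfl)
  · rintro ⟨t, v⟩
    rcases Fin.exists_fin_two.1 ⟨t, rfl⟩ with rfl | rfl
    · have := ofRows_pos_bottom (CatD.push f κ) b v.1
      rwa [CatD.push_compl f κ v.1 v.2] at this
    · have h1 := ofRows_pos_top (CatD.push f κ) b ((CatD.ctrctMap f κ).ζ ((), v)).1
      exact h1.trans (Prod.ext (h.2 ((), v)) rfl)

/-- The bottom row of an extension is forced, so only its top row is free. Together with
`extends_ofRows`, this matches the action of `𝔇` on arrangements with that of `ℭ` on top rows. -/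
theorem exists_of_extends_ofRows {ψ : Beads Q.X Q.Y} (h : Extends f (ofRows κ a) ψ) :
    ∃ b, extendsInj (CatD.ctrctMap f κ) a b ∧ ofRows (CatD.push f κ) b = ψ := by
  -- In an old column the bottom bead is transported by `i`; in a new one it is `ζ` at index `0`.
  -- These are the two cases defining `push`.
  have hκ : ψ.bottomBead = CatD.push f κ := DFunLike.ext _ _ fun v => by
    refine ψ.pos.injective ((ψ.pos_bottomBead v).trans (Eq.symm ?_))
    by_cases hv : v ∈ Set.range f.j
    · obtain ⟨y, rfl⟩ := hv
      rw [CatD.push_j, h.1, ofRows_pos_bottom]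
    · rw [CatD.push_compl f κ v hv]
      exact h.2 (0, ⟨v, hv⟩)
  obtain ⟨⟨κ', b⟩, rfl⟩ := (rowsEquiv Q.X Q.Y).surjective ψ
  have hκ' : κ' = CatD.push f κ :=
    (congrArg Sigma.fst ((rowsEquiv Q.X Q.Y).symm_apply_apply ⟨κ', b⟩)).symm.trans hκ
  subst hκ'
  refine ⟨b, ⟨fun x => ?_, fun p => ?_⟩, rfl⟩
  · have h1 := h.1 x.1
    rw [ofRows_pos_top κ a x] at h1
    exact congrArg Prod.fst ((ofRows_pos_top (CatD.push f κ) b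
      ((CatD.ctrctMap f κ).i x)).symm.trans h1)
  · exact congrArg Prod.fst ((ofRows_pos_top (CatD.push f κ) b
      ((CatD.ctrctMap f κ).ζ p).1).symm.trans (h.2 (1, p.2)))

end Extension

/-! ### The free bead functor is induced from `homFItr` -/

variable (k : Type u) [CommRing k]

/-- The component of the isomorphism from the induction of `k hom_FI(-,-)^tr` to
`k Beads^{[1,2]}`. -/
def rowsLinearEquiv (P : CatD.{u}) :
    (DirectSum (P.Y ↪ P.X) fun κ => (homFItr k).obj (P.ctrct κ)) ≃ₗ[k] (Beads P.X P.Y →₀ k) := by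
  classical
  -- A direct sum of free modules is free on the disjoint union of the bases, here indexed by pairs
  -- of rows.
  exact (sigmaFinsuppLequivDFinsupp (η := fun κ : P.Y ↪ P.X => ↥(Set.range κ)ᶜ ↪ P.Y) (N := k)
    k).symm ≪≫ₗ Finsupp.domLCongr (rowsEquiv P.X P.Y)

open Classical in
theorem rowsLinearEquiv_lof (P : CatD.{u}) (κ : P.Y ↪ P.X) (a : ↥(Set.range κ)ᶜ ↪ P.Y) :
    rowsLinearEquiv k P (DirectSum.lof k (P.Y ↪ P.X) (fun κ => (homFItr k).obj (P.ctrct κ)) κ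
      (Finsupp.single a 1 : (↥(Set.range κ)ᶜ ↪ P.Y) →₀ k)) = Finsupp.single (ofRows κ a) 1 := by
  have h : (sigmaFinsuppLequivDFinsupp (η := fun κ : P.Y ↪ P.X => ↥(Set.range κ)ᶜ ↪ P.Y) (N := k)
      k : _ ≃ₗ[k] _) (Finsupp.single ⟨κ, a⟩ 1) = DFinsupp.single κ (Finsupp.single a 1) :=
    sigmaFinsuppEquivDFinsupp_single _ _
  refine (congrArg (Finsupp.domLCongr (R := k) (M := k) (rowsEquiv P.X P.Y))
    ((LinearEquiv.symm_apply_eq _).2 h.symm)).trans ?_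
  exact Finsupp.domLCongr_single (R := k) _ _ _

theorem relSum_extends_ofRows {P Q : CatD.{u}} (f : P ⟶ Q) (κ : P.Y ↪ P.X)
    (a : ↥(Set.range κ)ᶜ ↪ P.Y) :
    relSum k (Extends f) (ofRows κ a) =
      Finsupp.lmapDomain k k (ofRows (CatD.push f κ))
        (relSum k (extendsInj (CatD.ctrctMap f κ)) a) :=
  relSum_eq_lmapDomain k _ _ (ofRows_injective _) (fun _ h => extends_ofRows f κ a h)
    fun _ h => exists_of_extends_ofRows f κ a h

/-- Bead arrangements are induced from injections. -/
def indHomFIIso : (ind k).obj (homFItr k) ≅ kBeads k :=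
  NatIso.ofComponents (fun P => (rowsLinearEquiv k P).toModuleIso) fun {P Q} f => by
    classical
    refine ModuleCat.hom_ext (DirectSum.linearMap_ext _ fun κ => Finsupp.lhom_ext' fun a =>
      LinearMap.ext_ring ?_)
    -- On the summand of a fixed bottom row, the isomorphism only adjoins that row to each basis
    -- vector.
    have h1 : (rowsLinearEquiv k Q : _ →ₗ[k] _) ∘ₗ
        DirectSum.lof k (Q.Y ↪ Q.X) (fun κ => (homFItr k).obj (Q.ctrct κ)) (CatD.push f κ) =
        Finsupp.lmapDomain k k (ofRows (CatD.push f κ)) :=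
      Finsupp.lhom_ext' fun b => LinearMap.ext_ring <|
        (rowsLinearEquiv_lof k Q _ b).trans Finsupp.mapDomain_single.symm
    have h2 := (relMap_single k (extendsInj (CatD.ctrctMap f κ)) a)
    refine (congrArg (rowsLinearEquiv k Q) ((indMap_lof (homFItr k) f κ _).trans
      (congrArg _ h2))).trans ?_
    refine (LinearMap.congr_fun h1 _).trans ?_
    refine (relSum_extends_ofRows k f κ a).symm.trans ?_
    refine (relMap_single k (Extends f) _).symm.trans ?_
    exact congrArg (relMap k (Extends f)) (rowsLinearEquiv_lof k P κ a).symm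

/-- `Beads_k^{[1,2],±}` corepresents the restriction to `𝔇` of `𝔈`-modules, evaluated at
`k Beads^{[1,2]}`. -/
def beadsPMHomEquiv (M : LinMod k (CatE k)) : (beadsPM k ⟶ M) ≃ (kBeads k ⟶ (resE k).obj M) :=
  (resEFullyFaithful k).homEquiv.trans <|
    ((resLiftE _ beadsPMObj_anti).homCongr (Iso.refl _)).trans <|
    (quotHomEquiv _ _ _ _).trans <|
    -- The condition of vanishing on the sign relations is automatic, since `ι + τ` acts by zero on
    -- an `𝔈`-module.
    Equiv.subtypeUnivEquiv fun η => beadsSub_le_ker (resE_anti M) η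

end Beads

/-! ### Both sides corepresent the same functor -/

section Corepresentability

variable (k : Type u) [CommRing k]

/-- The functor `G ↦ Hom(k Beads^{[1,2]}, G)` on `𝔈₀`-modules `G`, extended by zero to `𝔇`. -/
def homBeadsExtZero : LinMod k (CatE0 k) ⥤ Type (u + 1) :=
  resE0 k ⋙ Walled.extZero (Fin 2) (ModuleCat.{u} k) ⋙ coyoneda.obj (Opposite.op (kBeads k))

/-- Morphisms from `Beads_k^{[1,2],±}` to an extension by zero. -/
def beadsPMExtEquiv (G : LinMod k (CatE0 k)) :
    (beadsPM k ⟶ (extE k).obj G) ≃ (homBeadsExtZero k).obj G :=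
  (Beads.beadsPMHomEquiv k _).trans <| (Iso.refl _).homCongr ((extERes (k := k)).symm.app G)

/-- `H^𝔈_{𝔈₀} Beads_k^{[1,2],±}` corepresents `homBeadsExtZero`. -/
def corepresentableByHE : (homBeadsExtZero k).CorepresentableBy ((HE k).obj (beadsPM k)) where
  homEquiv {G} :=
    ((Adjunction.ofIsRightAdjoint (extE k)).homEquiv (beadsPM k) G).trans (beadsPMExtEquiv k G)
  homEquiv_comp {_ G'} g f :=
    -- Only the adjunction bijection needs a naturality lemma; the other bijections commute with
    -- postcomposition by definition.
    (congrArg (beadsPMExtEquiv k G') (Adjunction.homEquiv_naturality_right _ f g)).trans rfl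

/-- The functor `Ind₀ (H^ℭ_{ℭ₀} k hom_FI(-,-)^tr)` is the functor of indecomposables of
`Ind (k hom_FI(-,-)^tr)`. -/
def ind0HCIso : (ind0 k).obj ((HC k).obj (homFItr k)) ≅ Walled.indec ((ind k).obj (homFItr k)) :=
  (ind0 k).mapIso
    -- `HC` is an arbitrarily chosen left adjoint; uniqueness of adjoints replaces it by the
    -- explicit quotient `Walled.indec`.
    (((Adjunction.ofIsRightAdjoint (Walled.extZero Unit (ModuleCat.{u} k))).leftAdjointUniq
      (Walled.indecAdj Unit k)).app (homFItr k)) ≪≫ (indecIndIso (homFItr k)).symm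

/-- Morphisms from `Ind₀ (H^ℭ_{ℭ₀} k hom_FI(-,-)^tr)` to an `𝔈₀`-module. -/
def ind0HCEquiv (G : LinMod k (CatE0 k)) :
    ((ind0 k).obj ((HC k).obj (homFItr k)) ⟶ (resE0 k).obj G) ≃ (homBeadsExtZero k).obj G :=
  ((ind0HCIso k).homCongr (Iso.refl _)).trans <|
    (Walled.indecEquiv _ _).trans <| (Beads.indHomFIIso k).homCongr (Iso.refl _)

/-- `q^± Ind₀ (H^ℭ_{ℭ₀} k hom_FI(-,-)^tr)` corepresents `homBeadsExtZero`. -/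
def corepresentableByQpm0 : (homBeadsExtZero k).CorepresentableBy
    ((qpm0 k).obj ((ind0 k).obj ((HC k).obj (homFItr k)))) where
  homEquiv {G} := ((Adjunction.ofIsRightAdjoint (resE0 k)).homEquiv _ G).trans (ind0HCEquiv k G)
  homEquiv_comp {_ G'} g f :=
    (congrArg (ind0HCEquiv k G') (Adjunction.homEquiv_naturality_right _ f g)).trans rfl

end Corepresentability

end

theorem mainTheorem7 (k : Type u) [CommRing k] :
    Nonempty ((HE k).obj (beadsPM k) ≅
      (qpm0 k).obj ((ind0 k).obj ((HC k).obj (homFItr k)))) :=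
  ⟨(corepresentableByHE k).uniqueUpToIso (corepresentableByQpm0 k)⟩
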